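/- Let $S=\mathbb C[x_0,\dots,x_6]$ with its standard grading. "General" means: for all choices of coefficients outside the zero locus of some nonzero polynomial in these coefficients. (1) For general linear forms $L_1,\dots,L_8,L\in S$, put $I=(L_1^3,\dots,L_8^3)$ and $A=S/I$, and let $$s=\dim_{\mathbb C}\Big\{(g_1,\dots,g_8)\in S_3^{\,8} : \sum_{j=1}^8 g_jL_j^3=0\Big\}$$ be the dimension of the space of syzygies of degree $3$. Then $\dim A_5=238$, $s\ge 28$ and $\dim A_6=280+(s-28)$; the cokernel of the multiplication map $\times L:A_5\to A_6$ has dimension at least $s+15$; and $\times L:A_5\to A_6$ is not injective. Moreover $I$ fails the weak Lefschetz property in degree $5$: there is no linear form $\ell\in S$ for which $\times \ell:A_5\to A_6$ is injective or surjective. (2) For nine general points $p_1,\dots,p_9$ of $\mathbb P^5$, let $V$ be the space of cubic forms in six variables having multiplicity at least $2$ at $p_1,\dots,p_9$, and let $W\supseteq V$ be the space of cubic forms having multiplicity at least $2$ at $p_1,\dots,p_8$. Then $\dim V=2$ and $\dim W=8$, and the linear span $V\cdot W$ of all products $fg$ with $f\in V$ and $g\in W$ has dimension $15$ and consists of sextic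 forms having multiplicity at least $4$ at each of $p_1,\dots,p_8$. -/

import Mathlib

open MvPolynomial

/-- A property of `m`-tuples of vectors of `ℂⁿ` holds for the general tuple: it holds on the
complement of the zero locus of some nonzero polynomial in the `m * n` coordinates, that is, on a
nonempty Zariski-open set. -/
def ForGeneral {m n : ℕ} (Q : (Fin m → Fin n → ℂ) → Prop) : Prop :=
  ∃ P : MvPolynomial (Fin m × Fin n) ℂ, P ≠ 0 ∧
    ∀ v : Fin m → Fin n → ℂ, eval (fun k => v k.1 k.2) P ≠ 0 → Q v

/-- The linear form `∑ aᵢ xᵢ` with coefficient vector `a`. -/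
noncomputable def linearForm {n : ℕ} (a : Fin n → ℂ) : MvPolynomial (Fin n) ℂ :=
  ∑ i, C (a i) * X i

theorem linearForm_mem {n : ℕ} (a : Fin n → ℂ) :
    linearForm a ∈ homogeneousSubmodule (Fin n) ℂ 1 :=
  Submodule.sum_mem _ fun i _ => by
    simpa using (isHomogeneous_C (Fin n) (a i)).mul (isHomogeneous_X ℂ i)

/-- The ideal `(L₁³, …, L_r³)`, where `L_j` is the linear form with coefficient vector `a j`. -/
noncomputable def cubesIdeal {r n : ℕ} (a : Fin r → Fin n → ℂ) : Ideal (MvPolynomial (Fin n) ℂ) :=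
  Ideal.span (Set.range fun j => linearForm (a j) ^ 3)

/-- The degree `i` component `A_i` of the quotient `A` of the polynomial ring by `I`: the classes
of the forms of degree `i`. -/
noncomputable def gradedPiece {n : ℕ} (I : Ideal (MvPolynomial (Fin n) ℂ)) (i : ℕ) :
    Submodule ℂ (MvPolynomial (Fin n) ℂ ⧸ I) :=
  (homogeneousSubmodule (Fin n) ℂ i).map (Ideal.Quotient.mkₐ ℂ I).toLinearMap

theorem mul_mem_gradedPiece {n : ℕ} (I : Ideal (MvPolynomial (Fin n) ℂ)) (i : ℕ)
    (b : Fin n → ℂ) (x : MvPolynomial (Fin n) ℂ ⧸ I) (hx : x ∈ gradedPiece I i) :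
    LinearMap.mulLeft ℂ (Ideal.Quotient.mk I (linearForm b)) x ∈ gradedPiece I (i + 1) := by
  obtain ⟨f, hf, rfl⟩ := hx
  refine ⟨linearForm b * f, ?_, by simp⟩
  have h := IsHomogeneous.mul (linearForm_mem b) hf
  rw [add_comm] at h
  exact h

/-- The multiplication map `×L : A_i → A_{i+1}`, where `L` is the linear form with coefficient
vector `b`. -/
noncomputable def mulMap {n : ℕ} (I : Ideal (MvPolynomial (Fin n) ℂ)) (i : ℕ) (b : Fin n → ℂ) :
    gradedPiece I i →ₗ[ℂ] gradedPiece I (i + 1) :=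
  (LinearMap.mulLeft ℂ (Ideal.Quotient.mk I (linearForm b))).restrict (mul_mem_gradedPiece I i b)

/-- The weak Lefschetz property in degree `i`: `×L : A_i → A_{i+1}` has maximal rank for some
linear form `L` (equivalently, maximal rank being an open condition, for the general one). -/
def HasWLPInDegree {n : ℕ} (I : Ideal (MvPolynomial (Fin n) ℂ)) (i : ℕ) : Prop :=
  ∃ b : Fin n → ℂ, Function.Injective (mulMap I i b) ∨ Function.Surjective (mulMap I i b)

/-- The space of syzygies of degree `k` of `L₁³, …, L_r³`: the tuples `(g₁, …, g_r)` of forms of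
degree `k` with `∑ g_j L_j³ = 0`. It is `H⁰(K(k))`, where `K` is the kernel of
`(L₁³, …, L_r³) : 𝒪^r → 𝒪(3)`. -/
noncomputable def syzygies {r n : ℕ} (a : Fin r → Fin n → ℂ) (k : ℕ) :
    Submodule ℂ (Fin r → MvPolynomial (Fin n) ℂ) where
  carrier := {g | (∀ j, g j ∈ homogeneousSubmodule (Fin n) ℂ k) ∧
    ∑ j, g j * linearForm (a j) ^ 3 = 0}
  add_mem' := fun hf hg => ⟨fun j => Submodule.add_mem _ (hf.1 j) (hg.1 j), by
    simp [add_mul, Finset.sum_add_distrib, hf.2, hg.2]⟩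
  zero_mem' := ⟨fun _ => Submodule.zero_mem _, by simp⟩
  smul_mem' := fun c g hg => ⟨fun j => Submodule.smul_mem _ c (hg.1 j), by
    simp [← Finset.smul_sum, hg.2]⟩

/-- The iterated partial derivative of `F` along a list of variables. -/
noncomputable def iterPderiv {n : ℕ} (l : List (Fin n)) :
    MvPolynomial (Fin n) ℂ →ₗ[ℂ] MvPolynomial (Fin n) ℂ :=
  l.foldr (fun i D => (pderiv i).toLinearMap ∘ₗ D) LinearMap.id

/-- The space of forms of degree `d` having multiplicity at least `m` at each of the points
`[p₁], …, [p_r]` of projective space: all partial derivatives of order less than `m` vanish at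
each `p_j`. -/
noncomputable def formsWithMultiplicity {r n : ℕ} (d m : ℕ) (p : Fin r → Fin n → ℂ) :
    Submodule ℂ (MvPolynomial (Fin n) ℂ) where
  carrier := {F | F ∈ homogeneousSubmodule (Fin n) ℂ d ∧
    ∀ j, ∀ l : List (Fin n), l.length < m → eval (p j) (iterPderiv l F) = 0}
  add_mem' := fun hF hG => ⟨Submodule.add_mem _ hF.1 hG.1, fun j l hl => by
    simp [hF.2 j l hl, hG.2 j l hl]⟩
  zero_mem' := ⟨Submodule.zero_mem _, by simp⟩
  smul_mem' := fun c F hF => ⟨Submodule.smul_mem _ c hF.1, fun j l hl => by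
    simp [hF.2 j l hl]⟩

/-! ### General tuples -/

/-! Part (1). Up to scalars and a change of coordinates, eight linear forms in general position are
`x₁, …, x₇` and `σ = x₁ + ⋯ + x₇`. Let `J = (x₁³, …, x₇³)`. The `sl₂`-action on `S/J` makes
multiplication by `σ³` injective from degrees 2 and 3. Hence there are no syzygies of degree 2,
which gives `dim A₅ = 462 - 8·28`. In degree 3 the Koszul syzygies are independent, so `s ≥ 28`, and
`dim A₆ = 924 - 8·84 + s`.

The heart is non-injectivity (`not_injective_mulMap`). Let `ℓ = ∑ bᵢxᵢ` with the `bᵢ` distinct and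
nonzero. Modulo `(J, ℓ)` put `ω = ∏ (t - bᵢ)` and `γ = ω ∑ bᵢxᵢ/(t - bᵢ)`. As `ℓ = 0`, `γ` has
degree at most 5 in `t`; as `xᵢ³ = 0`, `ω⁴` divides `γ⁶`. The quotient has degree at most `30 - 28 =
2`, so its `t³` coefficient vanishes. Expanding at `t = 0` turns this into `σ³g = 0` for an explicit
cubic `g` (`pow_three_mul_extraCubic_eq_zero`). Lifting to `S` gives `σ³g - ℓf ∈ J` with `f` of
degree 5, so `ℓf ∈ I`. If `f` were in `I`, say `f ≡ rσ³` modulo `J`, injectivity of `σ³` would force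
`g = ℓr + ∑ cᵢxᵢ³`, which `extraCubic_ne` excludes. Since injectivity is open in `ℓ`, it fails for
every `ℓ`; the remaining claims are dimension counts.

Part (2). Independence of the double-point conditions is open, so one explicit example gives `dim V
= 56 - 54` and `dim W = 56 - 48`. A nonzero cubic singular at nine points in general position is
irreducible. So for a basis `F, G` of `V` the only relation `Fh + Gg = 0` with `h, g ∈ W` is, up to
scalars, the trivial one, and `dim VW = 2·8 - 1`. The Leibniz rule gives the multiplicities of the
products. -/

theorem ForGeneral.mono {m n : ℕ} {Q R : (Fin m → Fin n → ℂ) → Prop} (h : ForGeneral Q)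
    (hQR : ∀ v, Q v → R v) : ForGeneral R := by
  obtain ⟨P, hP, hPQ⟩ := h
  exact ⟨P, hP, fun v hv => hQR v (hPQ v hv)⟩

theorem ForGeneral.and {m n : ℕ} {Q R : (Fin m → Fin n → ℂ) → Prop} (hQ : ForGeneral Q)
    (hR : ForGeneral R) : ForGeneral fun v => Q v ∧ R v := by
  obtain ⟨P, hP, hPQ⟩ := hQ
  obtain ⟨P', hP', hPR⟩ := hR
  refine ⟨P * P', mul_ne_zero hP hP', fun v hv => ?_⟩
  rw [map_mul] at hv
  exact ⟨hPQ v (left_ne_zero_of_mul hv), hPR v (right_ne_zero_of_mul hv)⟩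

theorem ForGeneral.forall {m n : ℕ} {ι : Type*} [Finite ι] {Q : ι → (Fin m → Fin n → ℂ) → Prop}
    (h : ∀ i, ForGeneral (Q i)) : ForGeneral fun v => ∀ i, Q i v := by
  have := Fintype.ofFinite ι
  choose P hP hPQ using h
  refine ⟨∏ i, P i, Finset.prod_ne_zero_iff.2 fun i _ => hP i, fun v hv i => hPQ i v ?_⟩
  rw [map_prod, Finset.prod_ne_zero_iff] at hv
  exact hv i (Finset.mem_univ i)

/-- Any `n` vectors of a general tuple of vectors of `ℂⁿ` are linearly independent. -/
theorem forGeneral_det_ne_zero {m n : ℕ} (e : Fin n ↪ Fin m) :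
    ForGeneral fun v : Fin m → Fin n → ℂ => (Matrix.of fun i => v (e i)).det ≠ 0 := by
  refine ⟨rename (Prod.map e id) (Matrix.mvPolynomialX (Fin n) (Fin n) ℂ).det, ?_, fun v hv => ?_⟩
  · rw [Ne, map_eq_zero_iff _ (rename_injective _ (e.injective.prodMap Function.injective_id))]
    exact Matrix.det_mvPolynomialX_ne_zero _ _
  · rw [eval_rename, RingHom.map_det] at hv
    convert hv using 2
    ext i j
    simp [Matrix.mvPolynomialX]

/-- Injectivity of a matrix with polynomial entries is an open condition. -/
theorem exists_eval_ne_zero_imp_mulVec_injective {σ ι κ : Type*} [Fintype ι] [Fintype κ]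
    (M : Matrix ι κ (MvPolynomial σ ℂ)) (v₀ : σ → ℂ)
    (h : Function.Injective (M.map (eval v₀)).mulVec) :
    ∃ P : MvPolynomial σ ℂ, eval v₀ P ≠ 0 ∧
      ∀ v, eval v P ≠ 0 → Function.Injective (M.map (eval v)).mulVec := by
  classical
  -- A left inverse `N` of the matrix at `v₀` is kept constant: `det (N * M)` is a polynomial equal
  -- to 1 at `v₀`, and `M` is injective wherever it does not vanish.
  obtain ⟨g, hg⟩ := LinearMap.exists_leftInverse_of_injective (M.map (eval v₀)).mulVecLin
    (LinearMap.ker_eq_bot.2 h)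
  obtain ⟨N, hN⟩ : ∃ N : Matrix κ ι ℂ, N * M.map (eval v₀) = 1 := by
    refine ⟨LinearMap.toMatrix' g, ?_⟩
    rw [← LinearMap.toMatrix'_id, ← hg, LinearMap.toMatrix'_comp, ← Matrix.toLin'_apply',
      LinearMap.toMatrix'_toLin']
  have key : ∀ v, eval v (N.map (C : ℂ → MvPolynomial σ ℂ) * M).det =
      (N * M.map (eval v)).det := by
    intro v
    rw [RingHom.map_det, RingHom.mapMatrix_apply, Matrix.map_mul, Matrix.map_map]
    congr 2
    ext i j
    simp
  refine ⟨(N.map (C : ℂ → MvPolynomial σ ℂ) * M).det, ?_, fun v hv => ?_⟩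
  · rw [key, hN]
    simp
  · rw [key] at hv
    have hu := Matrix.mulVec_injective_of_isUnit
      ((Matrix.isUnit_iff_isUnit_det _).2 (isUnit_iff_ne_zero.2 hv))
    refine fun x y hxy => hu ?_
    simp only [← Matrix.mulVec_mulVec, hxy]

/-! ### Spaces of forms -/

instance (n k : ℕ) : FiniteDimensional ℂ (homogeneousSubmodule (Fin n) ℂ k) :=
  Module.Finite.iff_fg.2 (homogeneousSubmodule_fg (Fin n) ℂ k)

/-- The exponents of the monomials of degree `k` in `n` variables. -/
abbrev monomialExponents (n k : ℕ) : Finset (Fin n →₀ ℕ) := Finset.univ.finsuppAntidiag k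

theorem mem_monomialExponents {n k : ℕ} {d : Fin n →₀ ℕ} :
    d ∈ monomialExponents n k ↔ d.degree = k := by
  simp [Finset.mem_finsuppAntidiag, Finsupp.degree_eq_sum]

/-- The coefficients of a form of degree `k`. -/
noncomputable def formCoeffs (n k : ℕ) :
    homogeneousSubmodule (Fin n) ℂ k ≃ₗ[ℂ] (monomialExponents n k → ℂ) where
  toFun f d := coeff d f.1
  map_add' f g := by ext; simp
  map_smul' c f := by ext; simp
  invFun x := ⟨∑ d, monomial d.1 (x d), Submodule.sum_mem _ fun d _ =>
    isHomogeneous_monomial _ (mem_monomialExponents.1 d.2)⟩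
  left_inv f := by
    ext d
    by_cases hd : d ∈ monomialExponents n k
    · simp only [coeff_sum, coeff_monomial]
      rw [Finset.sum_eq_single ⟨d, hd⟩] <;> simp +contextual [Subtype.ext_iff]
    · simp only [coeff_sum, coeff_monomial]
      rw [Finset.sum_eq_zero, IsHomogeneous.coeff_eq_zero f.2
        (by rwa [mem_monomialExponents] at hd)]
      rintro ⟨e, he⟩ -
      rw [if_neg]
      rintro rfl
      exact hd he
  right_inv x := by
    ext d
    simp only [coeff_sum, coeff_monomial]
    rw [Finset.sum_eq_single d]
    · rw [if_pos rfl]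
    · exact fun e _ hed => if_neg fun h => hed (Subtype.ext h)
    · exact fun h => absurd (Finset.mem_univ d) h

theorem finrank_homogeneousSubmodule (n k : ℕ) :
    Module.finrank ℂ (homogeneousSubmodule (Fin n) ℂ k) = (n + k - 1).choose k := by
  rw [(formCoeffs n k).finrank_eq, Module.finrank_fintype_fun_eq_card, Fintype.card_coe,
    Finset.card_finsuppAntidiag_nat_eq_choose]
  simp

/-- The homomorphism `f(x) ↦ f(t x)`. -/
noncomputable def dilation (σ : Type*) :
    MvPolynomial σ ℂ →ₐ[ℂ] Polynomial (MvPolynomial σ ℂ) :=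
  aeval fun i => Polynomial.C (X i) * Polynomial.X

theorem coeff_dilation {σ : Type*} (f : MvPolynomial σ ℂ) (k : ℕ) :
    (dilation σ f).coeff k = homogeneousComponent k f := by
  induction f using MvPolynomial.induction_on' with
  | monomial d c =>
    have : dilation σ (monomial d c) = Polynomial.monomial d.degree (monomial d c) := by
      rw [dilation, aeval_monomial, Finsupp.prod]
      simp_rw [mul_pow, Finset.prod_mul_distrib]
      rw [Finset.prod_pow_eq_pow_sum, ← Polynomial.C_mul_X_pow_eq_monomial, monomial_eq,
          Finsupp.prod,
        ← mul_assoc, Polynomial.C_mul, map_prod]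
      simp only [Polynomial.C_pow]
      rfl
    rw [this, Polynomial.coeff_monomial]
    split_ifs with h
    · exact (homogeneousComponent_of_mem (isHomogeneous_monomial c h)).symm ▸ (by simp)
    · rw [homogeneousComponent_of_mem (isHomogeneous_monomial c rfl), if_neg (Ne.symm h)]
  | add p q hp hq => simp [hp, hq]

theorem dilation_of_isHomogeneous {σ : Type*} {f : MvPolynomial σ ℂ} {k : ℕ}
    (hf : f.IsHomogeneous k) : dilation σ f = Polynomial.monomial k f := by
  ext1 j
  rw [coeff_dilation, Polynomial.coeff_monomial, homogeneousComponent_of_mem hf]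
  simp [eq_comm]

/-- The factors of a nonzero form are forms. -/
theorem MvPolynomial.IsHomogeneous.of_mul {σ : Type*} {f g : MvPolynomial σ ℂ} {k : ℕ}
    (h : (f * g).IsHomogeneous k) (h0 : f * g ≠ 0) :
    ∃ i j, i + j = k ∧ f.IsHomogeneous i ∧ g.IsHomogeneous j := by
  have inj : ∀ f : MvPolynomial σ ℂ, f ≠ 0 → dilation σ f ≠ 0 := by
    intro f hf h
    apply hf
    rw [← sum_homogeneousComponent f]
    exact Finset.sum_eq_zero fun i _ => by rw [← coeff_dilation, h, Polynomial.coeff_zero]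
  have hf := inj f (left_ne_zero_of_mul h0)
  have hg := inj g (right_ne_zero_of_mul h0)
  have e : dilation σ f * dilation σ g = Polynomial.monomial k (f * g) := by
    rw [← map_mul, dilation_of_isHomogeneous h]
  -- Degree and trailing degree in `t` are both additive and agree on the product, a monomial in
  -- `t`; so they agree on each factor.
  have e1 := congrArg Polynomial.natDegree e
  have e2 := congrArg Polynomial.natTrailingDegree e
  rw [Polynomial.natDegree_mul hf hg, Polynomial.natDegree_monomial_eq _ h0] at e1
  rw [Polynomial.natTrailingDegree_mul hf hg, Polynomial.natTrailingDegree_monomial h0] at e2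
  have hom : ∀ f : MvPolynomial σ ℂ,
      (dilation σ f).natDegree = (dilation σ f).natTrailingDegree →
      f.IsHomogeneous (dilation σ f).natDegree := by
    intro f hf
    rw [← sum_homogeneousComponent f]
    refine IsHomogeneous.sum _ _ _ fun i _ => ?_
    rcases lt_trichotomy i (dilation σ f).natDegree with hi | hi | hi
    · rw [← coeff_dilation, Polynomial.coeff_eq_zero_of_lt_natTrailingDegree (hf ▸ hi)]
      exact isHomogeneous_zero _ _ _
    · rw [sum_homogeneousComponent, hi]
      exact homogeneousComponent_isHomogeneous _ _
    · rw [← coeff_dilation, Polynomial.coeff_eq_zero_of_natDegree_lt hi]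
      exact isHomogeneous_zero _ _ _
  have h1 := Polynomial.natTrailingDegree_le_natDegree (dilation σ f)
  have h2 := Polynomial.natTrailingDegree_le_natDegree (dilation σ g)
  exact ⟨_, _, e1, hom f (by omega), hom g (by omega)⟩

/-! ### Forms with assigned double points -/

theorem MvPolynomial.IsHomogeneous.eq_C {σ : Type*} {f : MvPolynomial σ ℂ}
    (h : f.IsHomogeneous 0) : f = C (coeff 0 f) :=
  totalDegree_eq_zero_iff_eq_C.1 ((totalDegree_zero_iff_isHomogeneous _).2 h)

theorem eval_linearForm {n : ℕ} (a x : Fin n → ℂ) :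
    eval x (linearForm a) = ∑ i, a i * x i := by
  simp [linearForm]

theorem eval_eq_zero_of_eval_pderiv_eq_zero {n d : ℕ} {F : MvPolynomial (Fin n) ℂ}
    (hF : F.IsHomogeneous (d + 1)) {x : Fin n → ℂ} (h : ∀ i, eval x (pderiv i F) = 0) :
    eval x F = 0 := by
  have e := congrArg (eval x) hF.sum_X_mul_pderiv
  simp only [map_sum, map_mul, h, mul_zero, Finset.sum_const_zero, nsmul_eq_mul, map_natCast] at e
  exact (mul_eq_zero.1 e.symm).resolve_left (Nat.cast_ne_zero.2 d.succ_ne_zero)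

theorem mem_formsWithMultiplicity_two {r n d : ℕ} {p : Fin r → Fin n → ℂ}
    {F : MvPolynomial (Fin n) ℂ} :
    F ∈ formsWithMultiplicity (d + 1) 2 p ↔
      F.IsHomogeneous (d + 1) ∧ ∀ j i, eval (p j) (pderiv i F) = 0 := by
  refine ⟨fun h => ⟨h.1, fun j i => h.2 j [i] (by simp)⟩, fun h => ⟨h.1, fun j l hl => ?_⟩⟩
  match l with
  | [] => exact eval_eq_zero_of_eval_pderiv_eq_zero h.1 (h.2 j)
  | [i] => exact h.2 j i
  | _ :: _ :: _ => simp at hl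

instance (r n d m : ℕ) (p : Fin r → Fin n → ℂ) :
    FiniteDimensional ℂ (formsWithMultiplicity d m p) :=
  Submodule.finiteDimensional_of_le (S₂ := homogeneousSubmodule (Fin n) ℂ d) fun _ h => h.1

/-- The points `p` impose independent conditions on the forms of degree `d` that are singular
at them. -/
def IndependentDoublePoints {r n : ℕ} (d : ℕ) (p : Fin r → Fin n → ℂ) : Prop :=
  ∀ c : Fin r → Fin n → ℂ,
    (∀ F ∈ homogeneousSubmodule (Fin n) ℂ d, ∑ j, ∑ i, c j i * eval (p j) (pderiv i F) = 0) → c = 0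

theorem IndependentDoublePoints.castSucc {r n d : ℕ} {p : Fin (r + 1) → Fin n → ℂ}
    (h : IndependentDoublePoints d p) : IndependentDoublePoints d fun j : Fin r => p j.castSucc :=
        by
  intro c hc
  have := h (Fin.snoc c 0) fun F hF => by
    rw [Fin.sum_univ_castSucc]
    simpa using hc F hF
  ext j i
  simpa using congrFun (congrFun this j.castSucc) i

/-- The values at the points of `p` of the first derivatives of a form. -/
noncomputable def gradientsAt {r n : ℕ} (d : ℕ) (p : Fin r → Fin n → ℂ) :
    homogeneousSubmodule (Fin n) ℂ d →ₗ[ℂ] (Fin r × Fin n → ℂ) :=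
  LinearMap.pi fun k => (aeval (p k.1)).toLinearMap ∘ₗ (pderiv k.2).toLinearMap ∘ₗ
    Submodule.subtype _

theorem gradientsAt_apply {r n d : ℕ} (p : Fin r → Fin n → ℂ)
    (F : homogeneousSubmodule (Fin n) ℂ d) (k : Fin r × Fin n) :
    gradientsAt d p F k = eval (p k.1) (pderiv k.2 F.1) := by
  simp [gradientsAt, aeval_eq_eval]

theorem IndependentDoublePoints.finrank {r n d : ℕ} {p : Fin r → Fin n → ℂ}
    (h : IndependentDoublePoints (d + 1) p) :
    r * n + Module.finrank ℂ (formsWithMultiplicity (d + 1) 2 p) = (n + d).choose (d + 1) := by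
  have hs : Function.Surjective (gradientsAt (d + 1) p) := by
    -- Dually, a functional on the target that kills the image is a relation between the conditions.
    rw [← LinearMap.dualMap_injective_iff, injective_iff_map_eq_zero]
    intro φ hφ
    have hz := h (fun j i => φ (Pi.single (j, i) 1)) fun F hF => by
      have := LinearMap.congr_fun hφ ⟨F, hF⟩
      rw [LinearMap.dualMap_apply, LinearMap.pi_apply_eq_sum_univ, Fintype.sum_prod_type] at this
      simp only [gradientsAt_apply, LinearMap.zero_apply, smul_eq_mul] at this
      rw [← this]
      refine Finset.sum_congr rfl fun j _ => Finset.sum_congr rfl fun i _ => ?_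
      rw [mul_comm]
      congr 2
      ext k
      simp [Pi.single_apply, eq_comm]
    refine LinearMap.pi_ext' fun k => LinearMap.ext_ring ?_
    simpa using congrFun (congrFun hz k.1) k.2
  have hk : formsWithMultiplicity (d + 1) 2 p =
      (LinearMap.ker (gradientsAt (d + 1) p)).map (Submodule.subtype _) := by
    ext F
    simp only [mem_formsWithMultiplicity_two, Submodule.mem_map, LinearMap.mem_ker, funext_iff,
      gradientsAt_apply, Pi.zero_apply, Submodule.subtype_apply, Prod.forall]
    exact ⟨fun hF => ⟨⟨F, hF.1⟩, hF.2, rfl⟩, by rintro ⟨F, hF, rfl⟩; exact ⟨F.2, hF⟩⟩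
  have hr := LinearMap.finrank_range_add_finrank_ker (gradientsAt (d + 1) p)
  rw [LinearMap.range_eq_top.2 hs, finrank_top, Module.finrank_fintype_fun_eq_card,
    finrank_homogeneousSubmodule, Fintype.card_prod, Fintype.card_fin, Fintype.card_fin] at hr
  rw [hk, Submodule.finrank_map_subtype_eq, hr]
  rfl

/-- Testing on monomials turns independence into injectivity of a matrix whose entries are
polynomials in the coordinates of the points. This is an open condition, so a single example
suffices. -/
theorem IndependentDoublePoints.forGeneral {r n d : ℕ} {p₀ : Fin r → Fin n → ℂ}
    (h : IndependentDoublePoints d p₀) :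
    ForGeneral fun p : Fin r → Fin n → ℂ => IndependentDoublePoints d p := by
  let M : Matrix (monomialExponents n d) (Fin r × Fin n) (MvPolynomial (Fin r × Fin n) ℂ) :=
    Matrix.of fun e k => rename (fun i => (k.1, i)) (pderiv k.2 (monomial e.1 1))
  have hM : ∀ (p : Fin r → Fin n → ℂ) (c : Fin r × Fin n → ℂ) (e : monomialExponents n d),
      (M.map (eval fun k => p k.1 k.2)).mulVec c e =
        ∑ j, ∑ i, c (j, i) * eval (p j) (pderiv i (monomial e.1 1)) := by
    intro p c e
    rw [Matrix.mulVec, dotProduct, Fintype.sum_prod_type]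
    simp only [M, Matrix.map_apply, Matrix.of_apply, eval_rename, mul_comm (c _)]
    rfl
  have hinj : ∀ p : Fin r → Fin n → ℂ, IndependentDoublePoints d p ↔
      Function.Injective (M.map (eval fun k => p k.1 k.2)).mulVec := by
    intro p
    rw [← Matrix.coe_mulVecLin, injective_iff_map_eq_zero]
    constructor
    · intro hp c hc
      have := hp (fun j i => c (j, i)) fun F hF => by
        have hF' : F = ∑ e : monomialExponents n d, coeff e.1 F • monomial e.1 1 := by
          have := congrArg Subtype.val ((formCoeffs n d).symm_apply_apply ⟨F, hF⟩)
          refine this.symm.trans (Finset.sum_congr rfl fun e _ => ?_)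
          rw [smul_monomial, smul_eq_mul, mul_one]
          rfl
        have he : ∀ e : monomialExponents n d, ∑ j, ∑ i, c (j, i) *
            eval (p j) (pderiv i (monomial e.1 1)) = 0 :=
          fun e => by rw [← hM, ← Matrix.mulVecLin_apply, hc]; rfl
        rw [hF']
        calc _ = ∑ e : monomialExponents n d, coeff e.1 F *
              ∑ j, ∑ i, c (j, i) * eval (p j) (pderiv i (monomial e.1 1)) := by
              simp only [map_sum, Derivation.map_smul, smul_eval, Finset.mul_sum]
              symm
              rw [Finset.sum_comm]
              refine Finset.sum_congr rfl fun j _ => ?_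
              rw [Finset.sum_comm]
              refine Finset.sum_congr rfl fun e _ => Finset.sum_congr rfl fun i _ => ?_
              ring
          _ = 0 := by simp only [he, mul_zero, Finset.sum_const_zero]
      ext k
      exact congrFun (congrFun this k.1) k.2
    · intro hp c hc
      have := hp (fun k => c k.1 k.2) <| by
        ext e
        rw [Matrix.mulVecLin_apply, hM]
        exact hc _ (isHomogeneous_monomial _ (mem_monomialExponents.1 e.2))
      ext j i
      exact congrFun this (j, i)
  obtain ⟨P, hP, hPi⟩ := exists_eval_ne_zero_imp_mulVec_injective M _ ((hinj p₀).1 h)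
  exact ⟨P, fun h0 => hP (by rw [h0, map_zero]), fun v hv => (hinj v).2 (hPi _ hv)⟩

theorem sum_mul_eval_pderiv_cubic {n : ℕ} (c x : Fin n → ℂ) (i j k : Fin n) :
    ∑ l, c l * eval x (pderiv l (X i * X j * X k)) =
      c i * (x j * x k) + c j * (x i * x k) + c k * (x i * x j) := by
  simp only [pderiv_mul, pderiv_X, map_add, map_mul, eval_X, mul_add, add_mul,
    Finset.sum_add_distrib, Pi.single_apply]
  simp

/-- Nine points of `ℙ⁵` that impose independent conditions on singular cubics. -/
noncomputable def ninePoints : Fin (6 + 3) → Fin 6 → ℂ :=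
  Fin.append (fun i => Pi.single i 1)
    ![![1, 1, 1, 1, 1, 1], ![1, 0, 1, 0, -1, -1], ![0, 1, 1, -1, 0, -1]]

theorem independentDoublePoints_ninePoints : IndependentDoublePoints 3 ninePoints := by
  intro lam h
  obtain ⟨a, ha⟩ : ∃ a, a = lam (Fin.natAdd 6 0) := ⟨_, rfl⟩
  obtain ⟨b, hb⟩ : ∃ b, b = lam (Fin.natAdd 6 1) := ⟨_, rfl⟩
  obtain ⟨c, hc⟩ : ∃ c, c = lam (Fin.natAdd 6 2) := ⟨_, rfl⟩
  have key : ∀ i j k : Fin 6,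
      ∑ m : Fin 6, (lam (Fin.castAdd 3 m) i *
          ((Pi.single m 1 : Fin 6 → ℂ) j * (Pi.single m 1 : Fin 6 → ℂ) k) +
        lam (Fin.castAdd 3 m) j * ((Pi.single m 1 : Fin 6 → ℂ) i * (Pi.single m 1 : Fin 6 → ℂ) k) +
        lam (Fin.castAdd 3 m) k * ((Pi.single m 1 : Fin 6 → ℂ) i * (Pi.single m 1 : Fin 6 → ℂ) j)) +
      ((a i + a j + a k) +
        (b i * (![1, 0, 1, 0, -1, -1] j * ![1, 0, 1, 0, -1, -1] k) +
          b j * (![1, 0, 1, 0, -1, -1] i * ![1, 0, 1, 0, -1, -1] k) +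
          b k * (![1, 0, 1, 0, -1, -1] i * ![1, 0, 1, 0, -1, -1] j)) +
        (c i * (![0, 1, 1, -1, 0, -1] j * ![0, 1, 1, -1, 0, -1] k) +
          c j * (![0, 1, 1, -1, 0, -1] i * ![0, 1, 1, -1, 0, -1] k) +
          c k * (![0, 1, 1, -1, 0, -1] i * ![0, 1, 1, -1, 0, -1] j))) = 0 := by
    intro i j k
    have := h (X i * X j * X k)
      (((isHomogeneous_X ℂ i).mul (isHomogeneous_X ℂ j)).mul (isHomogeneous_X ℂ k))
    simp only [sum_mul_eval_pderiv_cubic] at this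
    rw [Fin.sum_univ_add, Fin.sum_univ_three] at this
    simp only [ninePoints, Fin.append_left, Fin.append_right, ← ha, ← hb, ← hc] at this
    have one : ∀ l : Fin 6, (![1, 1, 1, 1, 1, 1] : Fin 6 → ℂ) l = 1 := by
      intro l; fin_cases l <;> rfl
    simpa [one] using this
  have single : ∀ i j : Fin 6, i ≠ j → ∀ m : Fin 6,
      (Pi.single m 1 : Fin 6 → ℂ) i * (Pi.single m 1 : Fin 6 → ℂ) j = 0 := by
    intro i j hij m
    by_cases him : i = m
    · subst him
      rw [Pi.single_eq_of_ne hij.symm, mul_zero]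
    · rw [Pi.single_eq_of_ne him, zero_mul]
  -- Squarefree cubic monomials are singular at the coordinate points. The 20 of them therefore give
  -- equations in the 18 unknowns `a`, `b`, `c` alone.
  have q : ∀ i j k : Fin 6, i < j → j < k → _ := fun i j k hij hjk => by
    have := key i j k
    simp only [single i j hij.ne, single j k hjk.ne, single i k (hij.trans hjk).ne, mul_zero,
      add_zero, Finset.sum_const_zero, zero_add] at this
    exact this
  have q012 := q 0 1 2 (by decide) (by decide)
  have q013 := q 0 1 3 (by decide) (by decide)
  have q014 := q 0 1 4 (by decide) (by decide)
  have q015 := q 0 1 5 (by decide) (by decide)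
  have q023 := q 0 2 3 (by decide) (by decide)
  have q024 := q 0 2 4 (by decide) (by decide)
  have q025 := q 0 2 5 (by decide) (by decide)
  have q034 := q 0 3 4 (by decide) (by decide)
  have q035 := q 0 3 5 (by decide) (by decide)
  have q045 := q 0 4 5 (by decide) (by decide)
  have q123 := q 1 2 3 (by decide) (by decide)
  have q124 := q 1 2 4 (by decide) (by decide)
  have q125 := q 1 2 5 (by decide) (by decide)
  have q134 := q 1 3 4 (by decide) (by decide)
  have q135 := q 1 3 5 (by decide) (by decide)
  have q145 := q 1 4 5 (by decide) (by decide)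
  have q234 := q 2 3 4 (by decide) (by decide)
  have q235 := q 2 3 5 (by decide) (by decide)
  have q245 := q 2 4 5 (by decide) (by decide)
  have q345 := q 3 4 5 (by decide) (by decide)
  simp [-neg_add_rev] at q012 q013 q014 q015 q023 q024 q025 q034 q035 q045
  simp [-neg_add_rev] at q123 q124 q125 q134 q135 q145 q234 q235 q245 q345
  -- The 20 equations have rank 18; the coefficients below solve for each unknown in turn.
  have ha0 : a 0 = 0 := by
    linear_combination (1 / 6) * q012 + (1 / 2) * q014 + (1 / 6) * q023 + (1 / 6) * q034 +
      (-1 / 3) * q124 + (-1 / 3) * q134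
  have ha1 : a 1 = 0 := by
    linear_combination (1 / 6) * q012 + (1 / 2) * q013 + (-1 / 3) * q023 + (-1 / 3) * q034 +
      (1 / 6) * q124 + (1 / 6) * q134
  have ha2 : a 2 = 0 := by
    linear_combination (2 / 3) * q012 + (-1) * q013 + (-1) * q014 + q015 + (1 / 6) * q023 +
      (2 / 3) * q034 + (-1 / 2) * q035 + (1 / 6) * q124 + (2 / 3) * q134 + (-1 / 2) * q145
  have ha3 : a 3 = 0 := by
    linear_combination (-1 / 3) * q012 + (1 / 2) * q013 + (-1 / 2) * q015 + (1 / 6) * q023 +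
      (-1 / 3) * q034 + (1 / 2) * q035 + (1 / 6) * q124 + (1 / 6) * q134
  have ha4 : a 4 = 0 := by
    linear_combination (-1 / 3) * q012 + (1 / 2) * q014 + (-1 / 2) * q015 + (1 / 6) * q023 +
      (1 / 6) * q034 + (1 / 6) * q124 + (-1 / 3) * q134 + (1 / 2) * q145
  have ha5 : a 5 = 0 := by
    linear_combination (-1 / 3) * q012 + (1 / 6) * q023 + (-1 / 3) * q034 + (1 / 2) * q035 +
      (1 / 6) * q124 + (-1 / 3) * q134 + (1 / 2) * q145
  have hb0 : b 0 = 0 := by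
    linear_combination (5 / 6) * q012 + (-2) * q013 + (-4 / 3) * q014 + (11 / 6) * q015 +
      (1 / 2) * q023 + (-1 / 3) * q024 + (-1 / 3) * q025 + (4 / 3) * q034 + (-5 / 6) * q035 +
      (1 / 3) * q045 + q134 + (-1 / 3) * q145 + (-2 / 3) * q245
  have hb1 : b 1 = 0 := by
    linear_combination (1 / 2) * q013 + (-1 / 2) * q015 + (-1 / 2) * q134 + (1 / 2) * q145
  have hb2 : b 2 = 0 := by
    linear_combination (-1 / 6) * q012 + (2 / 3) * q014 + (-1 / 6) * q015 + (1 / 2) * q023 +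
      (-1 / 3) * q024 + (-1 / 3) * q025 + (1 / 3) * q034 + (1 / 6) * q035 + (-2 / 3) * q045 +
      (-1) * q134 + (2 / 3) * q145 + (1 / 3) * q245
  have hb3 : b 3 = 0 := by
    linear_combination (-1 / 2) * q012 + (1 / 2) * q013 + q014 + (-1) * q015 + (1 / 2) * q023 +
      (-1) * q034 + (1 / 2) * q035 + (-1 / 2) * q134 + (1 / 2) * q145
  have hb4 : b 4 = 0 := by
    linear_combination (1 / 6) * q012 + (-1) * q013 + (-2 / 3) * q014 + (7 / 6) * q015 +
      (1 / 2) * q023 + (1 / 3) * q024 + (-2 / 3) * q025 + (2 / 3) * q034 + (-1 / 6) * q035 +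
      (-1 / 3) * q045 + (1 / 3) * q145 + (-1 / 3) * q245
  have hb5 : b 5 = 0 := by
    linear_combination (1 / 6) * q012 + (-1) * q013 + (1 / 3) * q014 + (1 / 6) * q015 +
      (1 / 2) * q023 + (-2 / 3) * q024 + (1 / 3) * q025 + (2 / 3) * q034 + (-1 / 6) * q035 +
      (-1 / 3) * q045 + (1 / 3) * q145 + (-1 / 3) * q245
  have hc0 : c 0 = 0 := by
    linear_combination (1 / 2) * q014 + (-1 / 2) * q015 + (-1 / 2) * q034 + (1 / 2) * q035
  have hc1 : c 1 = 0 := by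
    linear_combination (5 / 6) * q012 + (-4 / 3) * q013 + (-2) * q014 + (11 / 6) * q015 + q034 +
      (-1 / 3) * q035 + (-1 / 3) * q123 + (1 / 2) * q124 + (-1 / 3) * q125 + (4 / 3) * q134 +
      (1 / 3) * q135 + (-5 / 6) * q145 + (-2 / 3) * q235
  have hc2 : c 2 = 0 := by
    linear_combination (-1 / 6) * q012 + (2 / 3) * q013 + (-1 / 6) * q015 + (-1) * q034 +
      (2 / 3) * q035 + (-1 / 3) * q123 + (1 / 2) * q124 + (-1 / 3) * q125 + (1 / 3) * q134 +
      (-2 / 3) * q135 + (1 / 6) * q145 + (1 / 3) * q235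
  have hc3 : c 3 = 0 := by
    linear_combination (1 / 6) * q012 + (-2 / 3) * q013 + (-1) * q014 + (7 / 6) * q015 +
      (1 / 3) * q035 + (1 / 3) * q123 + (1 / 2) * q124 + (-2 / 3) * q125 + (2 / 3) * q134 +
      (-1 / 3) * q135 + (-1 / 6) * q145 + (-1 / 3) * q235
  have hc4 : c 4 = 0 := by
    linear_combination (-1 / 2) * q012 + q013 + (1 / 2) * q014 + (-1) * q015 + (-1 / 2) * q034 +
      (1 / 2) * q035 + (1 / 2) * q124 + (-1) * q134 + (1 / 2) * q145
  have hc5 : c 5 = 0 := by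
    linear_combination (1 / 6) * q012 + (1 / 3) * q013 + (-1) * q014 + (1 / 6) * q015 +
      (1 / 3) * q035 + (-2 / 3) * q123 + (1 / 2) * q124 + (1 / 3) * q125 + (2 / 3) * q134 +
      (-1 / 3) * q135 + (-1 / 6) * q145 + (-1 / 3) * q235
  have ha0 : a = 0 := by ext l; fin_cases l <;> assumption
  have hb0 : b = 0 := by ext l; fin_cases l <;> assumption
  have hc0 : c = 0 := by ext l; fin_cases l <;> assumption
  -- Among the gradients of `xᵢxⱼ²` at the coordinate points, only the `i`-th entry at the `j`-th
  -- point is nonzero: it is 1, or 3 when `i = j`.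
  have h1 : ∀ j i, lam (Fin.castAdd 3 j) i = 0 := by
    intro j i
    have := key i j j
    simp only [ha0, hb0, hc0, Pi.single_apply] at this
    by_cases hij : i = j
    · subst hij
      simp [Finset.sum_add_distrib] at this
      linear_combination this / 3
    · simpa [hij, Finset.sum_add_distrib] using this
  ext j i
  refine Fin.addCases (fun j => h1 j i) (fun j => ?_) j
  fin_cases j
  · exact congrFun (ha.symm.trans ha0) i
  · exact congrFun (hb.symm.trans hb0) i
  · exact congrFun (hc.symm.trans hc0) i

/-! ### Multiplicities of products -/

theorem iterPderiv_append_singleton {n : ℕ} (l : List (Fin n)) (i : Fin n)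
    (F : MvPolynomial (Fin n) ℂ) : iterPderiv (l ++ [i]) F = iterPderiv l (pderiv i F) := by
  induction l with
  | nil => rfl
  | cons j l ih =>
    change pderiv j (iterPderiv (l ++ [i]) F) = pderiv j (iterPderiv l (pderiv i F))
    rw [ih]

/-- Induction on the number of derivatives: by the Leibniz rule the innermost one falls on one
factor and costs that factor one order of vanishing. Truncated subtraction is harmless, since
vanishing to order 0 is no condition. -/
theorem eval_iterPderiv_mul_eq_zero {n : ℕ} (x : Fin n → ℂ) (l : List (Fin n)) :
    ∀ (a b : ℕ) (F G : MvPolynomial (Fin n) ℂ),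
      (∀ l : List (Fin n), l.length < a → eval x (iterPderiv l F) = 0) →
      (∀ l : List (Fin n), l.length < b → eval x (iterPderiv l G) = 0) →
      l.length < a + b → eval x (iterPderiv l (F * G)) = 0 := by
  induction l using List.reverseRecOn with
  | nil =>
    intro a b F G hF hG h
    change eval x (F * G) = 0
    rw [map_mul]
    rcases Nat.eq_zero_or_pos a with rfl | ha
    · rw [show eval x G = 0 from hG [] (by simpa using h), mul_zero]
    · rw [show eval x F = 0 from hF [] ha, zero_mul]
  | append_singleton l i ih =>
    intro a b F G hF hG h
    have hd : ∀ (c : ℕ) (F : MvPolynomial (Fin n) ℂ),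
        (∀ l : List (Fin n), l.length < c → eval x (iterPderiv l F) = 0) →
        ∀ l : List (Fin n), l.length < c - 1 → eval x (iterPderiv l (pderiv i F)) = 0 := by
      intro c F hF l hl
      rw [← iterPderiv_append_singleton]
      exact hF _ (by rw [List.length_append, List.length_singleton]; omega)
    rw [List.length_append, List.length_singleton] at h
    rw [iterPderiv_append_singleton, pderiv_mul, map_add, map_add,
      ih (a - 1) b _ _ (hd a F hF) hG (by omega), ih a (b - 1) _ _ hF (hd b G hG) (by omega),
      add_zero]

theorem formsWithMultiplicity_mul_le {r n d d' m m' : ℕ} (p : Fin r → Fin n → ℂ) :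
    formsWithMultiplicity d m p * formsWithMultiplicity d' m' p ≤
      formsWithMultiplicity (d + d') (m + m') p :=
  Submodule.mul_le.2 fun F hF G hG => ⟨IsHomogeneous.mul hF.1 hG.1, fun j l hl =>
    eval_iterPderiv_mul_eq_zero (p j) l m m' F G (hF.2 j) (hG.2 j) hl⟩

/-! ### Forms of degree one and two -/

theorem MvPolynomial.IsHomogeneous.exists_eq_linearForm {n : ℕ} {F : MvPolynomial (Fin n) ℂ}
    (hF : F.IsHomogeneous 1) : ∃ a, F = linearForm a := by
  refine ⟨fun i => coeff 0 (pderiv i F), ?_⟩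
  have h := hF.sum_X_mul_pderiv
  rw [one_smul] at h
  rw [← h, linearForm]
  refine Finset.sum_congr rfl fun i _ => ?_
  rw [h, mul_comm, ← IsHomogeneous.eq_C (hF.pderiv (i := i))]

theorem pderiv_linearForm {n : ℕ} (a : Fin n → ℂ) (i : Fin n) :
    pderiv i (linearForm a) = C (a i) := by
  simp only [linearForm, map_sum, pderiv_C_mul, pderiv_X, Pi.single_apply]
  simp

theorem pderiv_comm {n : ℕ} (i j : Fin n) (F : MvPolynomial (Fin n) ℂ) :
    pderiv i (pderiv j F) = pderiv j (pderiv i F) := by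
  have h : ⁅(pderiv i : Derivation ℂ (MvPolynomial (Fin n) ℂ) (MvPolynomial (Fin n) ℂ)),
      (pderiv j : Derivation ℂ (MvPolynomial (Fin n) ℂ) (MvPolynomial (Fin n) ℂ))⁆ = 0 := by
    refine derivation_ext fun k => ?_
    rw [Derivation.commutator_apply, pderiv_X, pderiv_X]
    simp only [Pi.single_apply]
    split_ifs <;> simp
  have := DFunLike.congr_fun h F
  rwa [Derivation.commutator_apply, Derivation.zero_apply, sub_eq_zero] at this

/-- The Hessian matrix of a quadratic form. -/
theorem MvPolynomial.IsHomogeneous.exists_hessian {n : ℕ} {F : MvPolynomial (Fin n) ℂ}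
    (hF : F.IsHomogeneous 2) : ∃ H : Matrix (Fin n) (Fin n) ℂ, H.IsSymm ∧
      ∀ i, pderiv i F = linearForm (H i) := by
  choose H hH using fun i => (hF.pderiv (i := i)).exists_eq_linearForm
  refine ⟨H, ?_, hH⟩
  ext i j
  have := pderiv_comm i j F
  rw [hH, hH, pderiv_linearForm, pderiv_linearForm] at this
  exact C_injective _ _ this

/-- The linear relation between `n + 1` vectors of `ℂⁿ` in general position involves all of
them. -/
theorem exists_relation_ne_zero {n : ℕ} {u : Fin (n + 1) → Fin n → ℂ}
    (hu : ∀ k : Fin (n + 1), (Matrix.of fun i => u (k.succAbove i)).det ≠ 0) :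
    ∃ d : Fin (n + 1) → ℂ, (∀ k, d k ≠ 0) ∧ ∑ k, d k • u k = 0 := by
  obtain ⟨d, hd0, hd⟩ : ∃ d : Fin (n + 1) → ℂ, d ≠ 0 ∧ ∑ k, d k • u k = 0 := by
    have : ¬ LinearIndependent ℂ u := by
      intro h
      simpa using h.fintype_card_le_finrank
    rw [Fintype.not_linearIndependent_iff] at this
    obtain ⟨d, hd, k, hk⟩ := this
    exact ⟨d, fun h => hk (congrFun h k), hd⟩
  refine ⟨d, fun k hk => ?_, hd⟩
  rw [Fin.sum_univ_succAbove _ k, hk, zero_smul, zero_add] at hd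
  have : Matrix.vecMul (fun i => d (k.succAbove i)) (Matrix.of fun i => u (k.succAbove i)) = 0 := by
    rw [Matrix.vecMul_eq_sum]
    exact hd
  have := Matrix.eq_zero_of_vecMul_eq_zero (hu k) this
  apply hd0
  ext j
  rcases Fin.eq_self_or_eq_succAbove k j with rfl | ⟨i, rfl⟩
  · exact hk
  · exact congrFun this i

/-- A symmetric bilinear form in six variables vanishes if it has four points in its radical
and three further isotropic points, all in general position. -/
theorem bilinForm_eq_zero_of_isotropic {H : Matrix (Fin 6) (Fin 6) ℂ} (hH : H.IsSymm)
    {u : Fin 7 → Fin 6 → ℂ}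
    (hu : ∀ k : Fin 7, (Matrix.of fun i => u (k.succAbove i)).det ≠ 0)
    (h₁ : ∀ k : Fin 7, k < 4 → H.mulVec (u k) = 0)
    (h₂ : ∀ k, u k ⬝ᵥ H.mulVec (u k) = 0) : H = 0 := by
  have hsymm : ∀ x y, x ⬝ᵥ H.mulVec y = y ⬝ᵥ H.mulVec x := by
    intro x y
    rw [Matrix.dotProduct_mulVec, ← Matrix.mulVec_transpose, hH.eq, dotProduct_comm]
  obtain ⟨d, hdk, hd⟩ : ∃ d : Fin 7 → ℂ, (∀ k, d k ≠ 0) ∧ ∑ k, d k • u k = 0 :=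
    exists_relation_ne_zero hu
  have hlin : ∀ y, ∑ k, d k * (u k ⬝ᵥ H.mulVec y) = 0 := by
    intro y
    have := congrArg (fun z => z ⬝ᵥ H.mulVec y) hd
    simpa [sum_dotProduct] using this
  have hrad : ∀ k, k < 4 → ∀ y, u k ⬝ᵥ H.mulVec y = 0 := fun k hk y => by
    rw [hsymm, h₁ k hk, dotProduct_zero]
  -- Modulo the radical, `u 4`, `u 5`, `u 6` are isotropic and satisfy one relation with nonzero
  -- coefficients. Pairing it with each of them gives three equations in the three mutual products,
  -- whose only solution is zero.
  have e4 := hlin (u 4)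
  have e5 := hlin (u 5)
  have e6 := hlin (u 6)
  simp only [Fin.sum_univ_seven, hrad 0 (by decide), hrad 1 (by decide), hrad 2 (by decide),
    hrad 3 (by decide), h₂, mul_zero, zero_add, add_zero] at e4 e5 e6
  rw [hsymm (u 6) (u 4)] at e4
  rw [hsymm (u 6) (u 5)] at e5
  rw [hsymm (u 5) (u 4)] at e4
  have h45 : u 4 ⬝ᵥ H.mulVec (u 5) = 0 := by
    have : d 4 * d 5 * (u 4 ⬝ᵥ H.mulVec (u 5)) * 2 = 0 := by
      linear_combination d 4 * e4 + d 5 * e5 - d 6 * e6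
    simpa [hdk] using this
  have h46 : u 4 ⬝ᵥ H.mulVec (u 6) = 0 := by simpa [h45, hdk] using e4
  have h56 : u 5 ⬝ᵥ H.mulVec (u 6) = 0 := by simpa [h45, hdk] using e5
  have hall : ∀ i j, u i ⬝ᵥ H.mulVec (u j) = 0 := by
    intro i j
    by_cases hi : i < 4
    · exact hrad i hi _
    by_cases hj : j < 4
    · rw [hsymm]
      exact hrad j hj _
    have h3 : ∀ k : Fin 7, ¬ k < 4 → k = 4 ∨ k = 5 ∨ k = 6 := by decide
    rcases h3 i hi with rfl | rfl | rfl <;> rcases h3 j hj with rfl | rfl | rfl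
    all_goals first | exact h₂ _ | assumption | (rw [hsymm]; assumption)
  have hz : ∀ j, H.mulVec (u j) = 0 := by
    intro j
    refine Matrix.eq_zero_of_mulVec_eq_zero (hu 0) ?_
    ext i
    exact hall _ j
  ext i j
  have : H i = 0 := by
    refine Matrix.eq_zero_of_mulVec_eq_zero (hu 0) ?_
    ext k
    rw [Pi.zero_apply, Matrix.mulVec, dotProduct_comm]
    exact congrFun (hz (Fin.succAbove 0 k)) i
  exact congrFun this j

/-! ### Cubics singular at nine general points -/

/-- Any `n` of the vectors `p j` of `ℂⁿ` are linearly independent. -/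
def InGeneralPosition {r n : ℕ} (p : Fin r → Fin n → ℂ) : Prop :=
  ∀ e : Fin n ↪ Fin r, (Matrix.of fun i => p (e i)).det ≠ 0

theorem forGeneral_inGeneralPosition (r n : ℕ) :
    ForGeneral fun p : Fin r → Fin n → ℂ => InGeneralPosition p :=
  ForGeneral.forall forGeneral_det_ne_zero

/-- If `n` of the points lay on the hyperplane, their invertible matrix would kill `a`. -/
theorem InGeneralPosition.card_filter_lt {r n : ℕ} {p : Fin r → Fin n → ℂ}
    (hp : InGeneralPosition p) {a : Fin n → ℂ} (ha : a ≠ 0) :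
    (Finset.univ.filter fun j => eval (p j) (linearForm a) = 0).card < n := by
  by_contra! h
  obtain ⟨t, ht, htn⟩ := Finset.exists_subset_card_eq h
  apply ha
  let e := t.orderEmbOfFin htn
  refine Matrix.eq_zero_of_mulVec_eq_zero (hp e.toEmbedding) ?_
  ext i
  have := (Finset.mem_filter.1 (ht (t.orderEmbOfFin_mem htn i))).2
  rw [eval_linearForm] at this
  rw [Pi.zero_apply, ← this, Matrix.mulVec, dotProduct]
  exact Finset.sum_congr rfl fun k _ => mul_comm _ _

/-- At a point on the hyperplane `m = 0` the gradient of `mq` is `q` times that of `m`; off it, `mq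
= 0` gives `q = 0`. So `q` vanishes at all nine points. At least four lie off the hyperplane, and
there `q` is singular, so they lie in the radical of its Hessian. Together with three more isotropic
points this forces `q = 0`. -/
theorem no_linear_factor_of_singular_at_nine {p : Fin 9 → Fin 6 → ℂ} (hp : InGeneralPosition p)
    {m q : MvPolynomial (Fin 6) ℂ} (hm : m.IsHomogeneous 1) (hq : q.IsHomogeneous 2)
    (h : ∀ j i, eval (p j) (pderiv i (m * q)) = 0) : m * q = 0 := by
  obtain ⟨a, rfl⟩ := hm.exists_eq_linearForm
  obtain ⟨H, hH, hHq⟩ := hq.exists_hessian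
  by_cases ha : a = 0
  · simp [ha, linearForm]
  have hcard := hp.card_filter_lt ha
  obtain ⟨i₀, hi₀⟩ : ∃ i, a i ≠ 0 := Function.ne_iff.1 ha
  have hq0 : ∀ j, eval (p j) q = 0 := by
    intro j
    by_cases hj : eval (p j) (linearForm a) = 0
    · have := h j i₀
      rw [pderiv_mul, map_add, map_mul, map_mul, hj, zero_mul, add_zero, pderiv_linearForm,
        eval_C] at this
      exact (mul_eq_zero.1 this).resolve_left hi₀
    · have := eval_eq_zero_of_eval_pderiv_eq_zero (d := 2) (hm.mul hq) (h j)
      rw [map_mul] at this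
      exact (mul_eq_zero.1 this).resolve_left hj
  have hq1 : ∀ j, eval (p j) (linearForm a) ≠ 0 → H.mulVec (p j) = 0 := by
    intro j hj
    ext i
    have := h j i
    rw [pderiv_mul, map_add, map_mul, map_mul, hq0, mul_zero, zero_add, hHq] at this
    rw [Pi.zero_apply, ← (mul_eq_zero.1 this).resolve_left hj, eval_linearForm]
    rfl
  -- Four points off the hyperplane come first; three of the remaining five complete them to seven.
  obtain ⟨e, he⟩ : ∃ e : Fin 7 ↪ Fin 9, ∀ k, k < 4 → eval (p (e k)) (linearForm a) ≠ 0 := by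
    have h4 : 4 ≤ (Finset.univ.filter fun j => ¬ eval (p j) (linearForm a) = 0).card := by
      have := Finset.card_filter_add_card_filter_not (s := Finset.univ)
        fun j => eval (p j) (linearForm a) = 0
      rw [Finset.card_univ, Fintype.card_fin] at this
      omega
    obtain ⟨t, ht, htn⟩ := Finset.exists_subset_card_eq h4
    have htc : tᶜ.card = 5 := by rw [Finset.card_compl, htn, Fintype.card_fin]
    let e₁ := t.orderEmbOfFin htn
    let e₂ := tᶜ.orderEmbOfFin htc
    refine ⟨⟨fun k => if hk : k.1 < 4 then e₁ ⟨k, hk⟩ else e₂ ⟨k - 4, by omega⟩, ?_⟩, ?_⟩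
    · intro k l hkl
      have h₁ := t.orderEmbOfFin_mem htn
      have h₂ := fun i => Finset.mem_compl.1 (tᶜ.orderEmbOfFin_mem htc i)
      dsimp only at hkl
      split_ifs at hkl with hk hl hl
      · exact Fin.ext (Fin.mk.inj_iff.1 (e₁.injective hkl))
      · exact absurd (hkl ▸ h₁ _) (h₂ _)
      · exact absurd (hkl ▸ h₁ _) (h₂ _)
      · have := Fin.mk.inj_iff.1 (e₂.injective hkl)
        exact Fin.ext (by omega)
    · intro k hk
      have hk' : k.1 < 4 := hk
      change eval (p (if hk : k.1 < 4 then e₁ ⟨k, hk⟩ else e₂ ⟨k - 4, by omega⟩)) _ ≠ 0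
      rw [dif_pos hk']
      exact (Finset.mem_filter.1 (ht (t.orderEmbOfFin_mem htn _))).2
  have hH0 : H = 0 := by
    refine bilinForm_eq_zero_of_isotropic (u := fun k => p (e k)) hH
      (fun k => hp ((Fin.succAboveEmb k).trans e)) (fun k hk => hq1 _ (he k hk)) fun k => ?_
    have := congrArg (eval (p (e k))) hq.sum_X_mul_pderiv
    simp only [map_sum, map_mul, eval_X, hHq, eval_linearForm, nsmul_eq_mul, hq0, mul_zero] at this
    exact this
  have hq00 : q = 0 := by
    have := hq.sum_X_mul_pderiv
    simp only [hHq, hH0] at this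
    simpa [linearForm] using this.symm
  rw [hq00, mul_zero]

/-- Factors of a form are forms, so a proper factorization of a cubic has a linear factor. -/
theorem irreducible_of_singular_at_nine {p : Fin 9 → Fin 6 → ℂ} (hp : InGeneralPosition p)
    {F : MvPolynomial (Fin 6) ℂ} (hF : F ∈ formsWithMultiplicity 3 2 p) (hF0 : F ≠ 0) :
    Irreducible F := by
  rw [mem_formsWithMultiplicity_two] at hF
  have unit : ∀ G : MvPolynomial (Fin 6) ℂ, G.IsHomogeneous 0 → G ≠ 0 → IsUnit G := by
    intro G hG hG0
    rw [hG.eq_C] at hG0 ⊢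
    exact (isUnit_iff_ne_zero.2 fun h => hG0 (by rw [h, map_zero])).map C
  refine ⟨fun hu => ?_, fun G K hGK => ?_⟩
  · have := (isUnit_iff_totalDegree_of_isReduced.1 hu).2
    rw [hF.1.totalDegree hF0] at this
    omega
  · subst hGK
    obtain ⟨i, j, hij, hG, hK⟩ := hF.1.of_mul hF0
    have hi : i = 0 ∨ i = 1 ∨ i = 2 ∨ i = 3 := by omega
    rcases hi with rfl | rfl | rfl | rfl
    · exact Or.inl (unit G hG (left_ne_zero_of_mul hF0))
    · obtain rfl : j = 2 := by omega
      exact absurd (no_linear_factor_of_singular_at_nine hp hG hK hF.2) hF0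
    · obtain rfl : j = 1 := by omega
      rw [mul_comm] at hF hF0
      exact absurd (no_linear_factor_of_singular_at_nine hp hK hG hF.2) hF0
    · obtain rfl : j = 0 := by omega
      exact Or.inr (unit K hK (right_ne_zero_of_mul hF0))

theorem MvPolynomial.IsHomogeneous.exists_eq_smul_of_dvd {σ : Type*} {F G : MvPolynomial σ ℂ}
    {k : ℕ} (hF : F.IsHomogeneous k) (hG : G.IsHomogeneous k) (h : F ∣ G) : ∃ c : ℂ, G = c • F := by
  obtain ⟨K, rfl⟩ := h
  by_cases h0 : F * K = 0
  · exact ⟨0, by rw [h0, zero_smul]⟩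
  obtain ⟨i, j, hij, hi, hj⟩ := hG.of_mul h0
  have := hF.inj_right hi (left_ne_zero_of_mul h0)
  obtain rfl : j = 0 := by omega
  exact ⟨coeff 0 K, by rw [smul_eq_C_mul, ← hj.eq_C, mul_comm]⟩

/-- The product space is the image of `W × W` under `(h, g) ↦ Fh + Gg`, with `F, G` a basis of the
pencil. In a relation the prime `F` divides `Gg` but not `G`, so `g` is a multiple of `F`: the
kernel is the line spanned by `(G, -F)`. -/
theorem finrank_formsWithMultiplicity_mul {p : Fin 9 → Fin 6 → ℂ} (hp : InGeneralPosition p)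
    {W : Submodule ℂ (MvPolynomial (Fin 6) ℂ)} (hW : W ≤ homogeneousSubmodule (Fin 6) ℂ 3)
    (hVW : formsWithMultiplicity 3 2 p ≤ W)
    (hV2 : Module.finrank ℂ (formsWithMultiplicity 3 2 p) = 2) :
    Module.finrank ℂ ↥(formsWithMultiplicity 3 2 p * W) + 1 = 2 * Module.finrank ℂ W := by
  have := Submodule.finiteDimensional_of_le hW
  let b := Module.finBasisOfFinrankEq ℂ _ hV2
  obtain ⟨F, hFb⟩ : ∃ F, F = b 0 := ⟨_, rfl⟩
  obtain ⟨G, hGb⟩ : ∃ G, G = b 1 := ⟨_, rfl⟩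
  have hspan : ∀ K ∈ formsWithMultiplicity 3 2 p, ∃ x y : ℂ, K = x • F.1 + y • G.1 := by
    intro K hK
    have := congrArg Subtype.val (b.sum_repr ⟨K, hK⟩)
    rw [Fin.sum_univ_two, ← hFb, ← hGb] at this
    exact ⟨_, _, this.symm⟩
  have hF0 : F.1 ≠ 0 := fun h => b.ne_zero 0 (Subtype.ext (hFb ▸ h))
  have hFG : ¬ ∃ c : ℂ, G.1 = c • F.1 := by
    rintro ⟨c, hc⟩
    have h1 : b 1 = c • b 0 := by
      rw [← hFb, ← hGb]
      exact Subtype.ext hc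
    have := congrArg (fun z => b.repr z 1) h1
    simp at this
  have hirr := (irreducible_of_singular_at_nine hp F.2 hF0).prime
  let f : W × W →ₗ[ℂ] MvPolynomial (Fin 6) ℂ :=
    (LinearMap.mulLeft ℂ F.1 ∘ₗ W.subtype).coprod (LinearMap.mulLeft ℂ G.1 ∘ₗ W.subtype)
  have hf : ∀ x : W × W, f x = F.1 * x.1.1 + G.1 * x.2.1 := fun x => rfl
  have hrange : LinearMap.range f = formsWithMultiplicity 3 2 p * W := by
    apply le_antisymm
    · rintro _ ⟨x, rfl⟩
      exact add_mem (Submodule.mul_mem_mul F.2 x.1.2) (Submodule.mul_mem_mul G.2 x.2.2)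
    · refine Submodule.mul_le.2 fun K hK w hw => ?_
      obtain ⟨x, y, rfl⟩ := hspan K hK
      refine ⟨(x • ⟨w, hw⟩, y • ⟨w, hw⟩), ?_⟩
      rw [hf]
      simp [add_mul]
  have hker : LinearMap.ker f = ℂ ∙ ((⟨G, hVW G.2⟩, -⟨F, hVW F.2⟩) : W × W) := by
    apply le_antisymm
    · rintro ⟨h, g⟩ hx
      rw [LinearMap.mem_ker, hf] at hx
      dsimp only at hx
      have hdvd : F.1 ∣ G.1 * g.1 := ⟨-h.1, by linear_combination hx⟩
      rcases hirr.dvd_or_dvd hdvd with hd | hd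
      · exact absurd (IsHomogeneous.exists_eq_smul_of_dvd F.2.1 G.2.1 hd) hFG
      · obtain ⟨c, hc⟩ := IsHomogeneous.exists_eq_smul_of_dvd F.2.1 (hW g.2) hd
        rw [Submodule.mem_span_singleton]
        refine ⟨-c, Prod.ext (Subtype.ext ?_) (Subtype.ext ?_)⟩
        · have : F.1 * (h.1 + c • G.1) = 0 := by
            rw [← hx, hc, smul_eq_C_mul, smul_eq_C_mul]
            ring
          have := (mul_eq_zero.1 this).resolve_left hF0
          simpa [neg_smul] using (eq_neg_of_add_eq_zero_left this).symm
        · simpa using hc.symm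
    · rw [Submodule.span_singleton_le_iff_mem, LinearMap.mem_ker, hf]
      simp [mul_comm]
  have hr := LinearMap.finrank_range_add_finrank_ker f
  rw [hrange, hker, finrank_span_singleton, Module.finrank_prod] at hr
  · omega
  · intro h
    exact hF0 (by simpa using congrArg (fun z => (z.2 : MvPolynomial (Fin 6) ℂ)) h)

theorem forGeneral_singular_cubics : ForGeneral (fun p : Fin 9 → Fin 6 → ℂ =>
    let q : Fin 8 → Fin 6 → ℂ := fun j => p j.castSucc
    Module.finrank ℂ (formsWithMultiplicity 3 2 p) = 2 ∧
    Module.finrank ℂ (formsWithMultiplicity 3 2 q) = 8 ∧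
    Module.finrank ℂ ↥(formsWithMultiplicity 3 2 p * formsWithMultiplicity 3 2 q) = 15 ∧
    formsWithMultiplicity 3 2 p * formsWithMultiplicity 3 2 q ≤ formsWithMultiplicity 6 4 q) := by
  refine (independentDoublePoints_ninePoints.forGeneral.and
    (forGeneral_inGeneralPosition 9 6)).mono fun p hp => ?_
  intro q
  have hVW : formsWithMultiplicity 3 2 p ≤ formsWithMultiplicity 3 2 q :=
    fun F hF => ⟨hF.1, fun j => hF.2 j.castSucc⟩
  have hV : Module.finrank ℂ (formsWithMultiplicity 3 2 p) = 2 := by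
    have : 9 * 6 + Module.finrank ℂ (formsWithMultiplicity 3 2 p) = 56 := hp.1.finrank
    omega
  have hW : Module.finrank ℂ (formsWithMultiplicity 3 2 q) = 8 := by
    have : 8 * 6 + Module.finrank ℂ (formsWithMultiplicity 3 2 q) = 56 :=
      (IndependentDoublePoints.castSucc hp.1).finrank
    omega
  refine ⟨hV, hW, ?_, (mul_le_mul' hVW le_rfl).trans (formsWithMultiplicity_mul_le q)⟩
  have := finrank_formsWithMultiplicity_mul hp.2
    (W := formsWithMultiplicity 3 2 q) (fun F hF => hF.1) hVW hV
  omega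

/-! ### The strong Lefschetz property of `ℂ[x₁, …, xₙ] / (x₁³, …, xₙ³)` -/

/-- The ideal `(x₁³, …, xₙ³)`. -/
noncomputable def varCubes (n : ℕ) : Ideal (MvPolynomial (Fin n) ℂ) :=
  Ideal.span (Set.range fun i => X i ^ 3)

theorem X_pow_three_mem_varCubes {n : ℕ} (i : Fin n) : X i ^ 3 ∈ varCubes n :=
  Ideal.subset_span ⟨i, rfl⟩

/-- The lowering operator of the `sl₂`-action on `ℂ[x₁, …, xₙ] / (x₁³, …, xₙ³)` whose raising
operator is the multiplication by `x₁ + ⋯ + xₙ`. -/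
noncomputable def lowering (n : ℕ) : MvPolynomial (Fin n) ℂ →ₗ[ℂ] MvPolynomial (Fin n) ℂ :=
  ∑ i, (2 • (pderiv i).toLinearMap -
    LinearMap.mulLeft ℂ (X i) ∘ₗ (pderiv i).toLinearMap ∘ₗ (pderiv i).toLinearMap)

theorem lowering_apply {n : ℕ} (f : MvPolynomial (Fin n) ℂ) :
    lowering n f = ∑ i, (2 * pderiv i f - X i * pderiv i (pderiv i f)) := by
  simp [lowering, LinearMap.sum_apply, two_mul, two_smul]

/-- The factor 2 in the operator is the one for which `2∂ - x∂²` kills `x³`; hence the operator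
descends to the quotient. -/
theorem lowering_mem_varCubes {n : ℕ} {f : MvPolynomial (Fin n) ℂ} (hf : f ∈ varCubes n) :
    lowering n f ∈ varCubes n := by
  obtain ⟨g, rfl⟩ := Ideal.mem_span_range_iff_exists_fun.1 hf
  rw [map_sum]
  refine Ideal.sum_mem _ fun i _ => ?_
  have : lowering n (g i * X i ^ 3) = (lowering n (g i) - 6 * pderiv i (g i)) * X i ^ 3 := by
    have h6 : 6 * pderiv i (g i) = ∑ j, if j = i then 6 * pderiv i (g i) else 0 := by simp
    rw [lowering_apply, lowering_apply, h6, ← Finset.sum_sub_distrib, Finset.sum_mul]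
    refine Finset.sum_congr rfl fun j _ => ?_
    by_cases hj : j = i
    · subst hj
      simp only [pderiv_mul, pderiv_pow, pderiv_X_self, if_true, map_add, pderiv_one,
          Derivation.map_natCast]
      push_cast
      ring
    · have hij : i ≠ j := Ne.symm hj
      simp only [pderiv_mul, pderiv_pow, pderiv_X_of_ne hij, if_neg hj, mul_zero, add_zero]
      ring
  rw [this]
  exact Ideal.mul_mem_left _ _ (X_pow_three_mem_varCubes i)

theorem lowering_isHomogeneous {n k : ℕ} {f : MvPolynomial (Fin n) ℂ}
    (hf : f.IsHomogeneous (k + 1)) : (lowering n f).IsHomogeneous k := by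
  rw [lowering_apply]
  refine IsHomogeneous.sum _ _ _ fun i _ => ?_
  have h1 : (pderiv i f).IsHomogeneous k := hf.pderiv
  have h2 : (X i * pderiv i (pderiv i f)).IsHomogeneous k := by
    cases k with
    | zero =>
      rw [totalDegree_eq_zero_iff_eq_C.1 ((totalDegree_zero_iff_isHomogeneous _).2 h1), pderiv_C,
        mul_zero]
      exact isHomogeneous_zero _ _ _
    | succ k =>
      have := (isHomogeneous_X ℂ i).mul (h1.pderiv (i := i))
      rwa [Nat.add_sub_cancel, add_comm] at this
  refine IsHomogeneous.sub ?_ h2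
  rw [two_mul]
  exact h1.add h1

/-- This is the `sl₂` commutator. Each variable contributes `2 - 2xᵢ∂ᵢ`, and the Euler relation sums
these to `2(n - k)` in degree `k`. -/
theorem lowering_sum_X_mul {n k : ℕ} {f : MvPolynomial (Fin n) ℂ} (hf : f.IsHomogeneous k) :
    lowering n ((∑ i, X i) * f) =
      (∑ i, X i) * lowering n f + C (2 * (n - k : ℂ)) * f := by
  have hd : ∀ i : Fin n, pderiv i (∑ j : Fin n, X j : MvPolynomial (Fin n) ℂ) = 1 := by
    intro i
    simp [pderiv_X, Pi.single_apply]
  have he := hf.sum_X_mul_pderiv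
  rw [nsmul_eq_mul] at he
  rw [lowering_apply, lowering_apply, Finset.mul_sum]
  have : C (2 * (n - k : ℂ)) * f = ∑ i : Fin n, (2 * f - 2 * (X i * pderiv i f)) := by
    rw [Finset.sum_sub_distrib, ← Finset.mul_sum, ← Finset.mul_sum, he]
    simp [show (C 2 : MvPolynomial (Fin n) ℂ) = 2 from map_ofNat C 2]
    ring
  rw [this, ← Finset.sum_add_distrib]
  refine Finset.sum_congr rfl fun i _ => ?_
  simp only [pderiv_mul, hd, map_add, one_mul]
  ring

/-- Let `Λ` be the lowering operator and `σ = ∑ xᵢ`. The term `m f` makes the induction run: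
commuting gives `σΛf + m'f ∈ J` with `m' = 2(n - k) + m > 0`, and applying `Λ` gives the same
hypothesis for `Λf` in degree `k - 1`. So `Λf ∈ J`, and then `m'f ∈ J`. -/
theorem mem_varCubes_of_lowering {n : ℕ} : ∀ (k : ℕ), k < n → ∀ (m : ℕ)
    (f : MvPolynomial (Fin n) ℂ), f.IsHomogeneous k →
    lowering n ((∑ i, X i) * f) + C (m : ℂ) * f ∈ varCubes n → f ∈ varCubes n := by
  intro k
  induction k with
  | zero =>
    intro hk m f hf h
    have hf0 := totalDegree_eq_zero_iff_eq_C.1 ((totalDegree_zero_iff_isHomogeneous _).2 hf)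
    have : lowering n f = 0 := by rw [hf0, lowering_apply]; simp
    rw [lowering_sum_X_mul hf, this, mul_zero, zero_add, ← add_mul, ← C_add] at h
    refine (Ideal.unit_mul_mem_iff_mem _ ((isUnit_iff_ne_zero.2 ?_).map C)).1 h
    have : (2 * n + m : ℂ) ≠ 0 := by exact_mod_cast (by omega : 2 * n + m ≠ 0)
    simpa using this
  | succ k ih =>
    intro hk m f hf h
    rw [lowering_sum_X_mul hf, add_assoc, ← add_mul, ← C_add] at h
    obtain ⟨m', hm'⟩ : ∃ m' : ℕ, m' = 2 * (n - (k + 1)) + m := ⟨_, rfl⟩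
    have hc : (2 * (n - (k + 1 : ℕ)) + m : ℂ) = (m' : ℂ) := by
      rw [hm']
      push_cast [Nat.cast_sub hk.le]
      ring
    rw [hc] at h
    have h1 : lowering n f ∈ varCubes n := by
      refine ih (by omega) m' _ (lowering_isHomogeneous hf) ?_
      have := lowering_mem_varCubes h
      rwa [map_add, C_mul', map_smul, ← C_mul'] at this
    have h2 := (Ideal.add_mem_iff_right _ (Ideal.mul_mem_left _ (∑ i, X i) h1)).1 h
    refine (Ideal.unit_mul_mem_iff_mem _ ((isUnit_iff_ne_zero.2 ?_).map C)).1 h2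
    exact_mod_cast (by omega : m' ≠ 0)

theorem mem_varCubes_of_sum_X_mul_mem {n k : ℕ} (hk : k < n) {f : MvPolynomial (Fin n) ℂ}
    (hf : f.IsHomogeneous k) (h : (∑ i, X i) * f ∈ varCubes n) : f ∈ varCubes n :=
  mem_varCubes_of_lowering k hk 0 f hf (by simpa using lowering_mem_varCubes h)

theorem mem_varCubes_of_sum_X_pow_three_mul_mem {n k : ℕ} (hk : k + 2 < n)
    {f : MvPolynomial (Fin n) ℂ} (hf : f.IsHomogeneous k)
    (h : (∑ i, X i) ^ 3 * f ∈ varCubes n) : f ∈ varCubes n := by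
  have hs : (∑ i : Fin n, X i : MvPolynomial (Fin n) ℂ).IsHomogeneous 1 :=
    IsHomogeneous.sum _ _ _ fun i _ => isHomogeneous_X ℂ i
  have h1 := hs.mul hf
  have h2 := hs.mul h1
  refine mem_varCubes_of_sum_X_mul_mem (by omega) hf
    (mem_varCubes_of_sum_X_mul_mem (by omega) h1 (mem_varCubes_of_sum_X_mul_mem (by omega) h2 ?_))
  convert h using 1
  ring

/-! ### Homogeneous coefficients -/

theorem homogeneousComponent_mul_of_isHomogeneous {σ : Type*} {g h : MvPolynomial σ ℂ} {d : ℕ}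
    (hh : h.IsHomogeneous d) (k : ℕ) :
    homogeneousComponent (k + d) (g * h) = homogeneousComponent k g * h := by
  rw [← coeff_dilation, map_mul, dilation_of_isHomogeneous hh, Polynomial.coeff_mul_monomial,
    coeff_dilation]

/-- The coefficients of a relation between forms can be taken to be forms. -/
theorem MvPolynomial.IsHomogeneous.eq_sum_homogeneousComponent_mul {σ ι : Type*} [Fintype ι]
    {f : MvPolynomial σ ℂ} {g h : ι → MvPolynomial σ ℂ} {d k : ℕ} (hf : f.IsHomogeneous (k + d))
    (hh : ∀ i, (h i).IsHomogeneous d) (e : ∑ i, g i * h i = f) :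
    ∑ i, homogeneousComponent k (g i) * h i = f := by
  have := congrArg (homogeneousComponent (k + d)) e
  rw [map_sum, homogeneousComponent_of_mem hf, if_pos rfl] at this
  rw [← this]
  exact Finset.sum_congr rfl fun i _ => (homogeneousComponent_mul_of_isHomogeneous (hh i) k).symm

theorem eq_zero_of_mem_varCubes {n k : ℕ} (hk : k < 3) {f : MvPolynomial (Fin n) ℂ}
    (hf : f.IsHomogeneous k) (h : f ∈ varCubes n) : f = 0 := by
  obtain ⟨g, hg⟩ := Ideal.mem_span_range_iff_exists_fun.1 h
  have := congrArg (homogeneousComponent k) hg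
  rw [homogeneousComponent_of_mem hf, if_pos rfl, map_sum] at this
  rw [← this]
  refine Finset.sum_eq_zero fun i _ => ?_
  rw [← coeff_dilation, map_mul, dilation_of_isHomogeneous ((isHomogeneous_X ℂ i).pow 3),
    ← Polynomial.C_mul_X_pow_eq_monomial, ← mul_assoc, Polynomial.coeff_mul_X_pow',
    if_neg (by omega)]

/-- Cubes of variables have no syzygies of degree two. -/
theorem eq_zero_of_sum_mul_X_pow_three {n : ℕ} {q : Fin n → MvPolynomial (Fin n) ℂ}
    (hq : ∀ i, (q i).IsHomogeneous 2) (h : ∑ i, q i * X i ^ 3 = 0) : q = 0 := by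
  ext i m
  by_cases hm : m.degree = 2
  · have := congrArg (coeff (m + Finsupp.single i 3)) h
    rw [coeff_sum, Finset.sum_eq_single i] at this
    · rw [X_pow_eq_monomial, coeff_mul_monomial, mul_one, coeff_zero] at this
      rw [this]
      simp
    · intro j _ hj
      rw [X_pow_eq_monomial, coeff_mul_monomial', if_neg]
      intro hle
      have h1 := hle j
      rw [Finsupp.single_eq_same, Finsupp.add_apply, Finsupp.single_eq_of_ne hj, add_zero] at h1
      have h2 := Finsupp.le_degree j m
      omega
    · exact fun h => absurd (Finset.mem_univ i) h
  · rw [(hq i).coeff_eq_zero hm]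
    simp

/-! ### The extra relation -/

/-- If `γⱼ³ = 0` and `γⱼ` is divisible by the `pᵢ`, `i ≠ j`, then `∏ pᵢ⁴` divides `(∑ γᵢ)⁶`. -/
theorem prod_pow_four_dvd_sum_pow_six {R : Type*} [CommRing R] {ι : Type*} [Fintype ι]
    {p : ι → R} (hp : Pairwise fun i j => IsCoprime (p i) (p j)) {γ : ι → R}
    (hγ : ∀ i, γ i ^ 3 = 0) (hpγ : ∀ i j, i ≠ j → p i ∣ γ j) :
    (∏ i, p i) ^ 4 ∣ (∑ i, γ i) ^ 6 := by
  classical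
  rw [← Finset.prod_pow]
  refine Fintype.prod_dvd_of_coprime (fun i j hij => (hp hij).pow) fun i => ?_
  obtain ⟨δ, hδ⟩ : p i ∣ ∑ j ∈ Finset.univ.erase i, γ j :=
    Finset.dvd_sum fun j hj => hpγ i j (Finset.ne_of_mem_erase hj).symm
  rw [← Finset.add_sum_erase _ _ (Finset.mem_univ i), hδ]
  -- In the binomial expansion of `(γᵢ + pᵢδ)⁶` the terms containing `γᵢ³` vanish; the others
  -- contain `(pᵢδ)⁴`.
  refine ⟨δ ^ 4 * ((p i * δ) ^ 2 + 6 * (p i * δ) * γ i + 15 * γ i ^ 2), ?_⟩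
  linear_combination (γ i ^ 3 + 6 * γ i ^ 2 * (p i * δ) + 15 * γ i * (p i * δ) ^ 2 +
    20 * (p i * δ) ^ 3) * hγ i

/-- The polynomial `∏ (t - bᵢ)`. -/
noncomputable abbrev nodePoly {m : ℕ} (b : Fin m → ℂ) : Polynomial ℂ :=
  ∏ i, (Polynomial.X - Polynomial.C (b i))

/-- The cofactor `g` of `y₀³` in the coefficient of `t³` of `∏ (t - bᵢ)² (y₀ + y₁t + y₂t² + y₃t³)⁶`,
where `w` is the sequence of coefficients of `∏ (t - bᵢ)²`. -/
noncomputable def extraCubic {R : Type*} [CommRing R] [Algebra ℂ R] (w : ℕ → ℂ) (y : ℕ → R) : R :=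
  20 * algebraMap ℂ R (w 0) * y 1 ^ 3 +
  y 0 * (15 * (algebraMap ℂ R (w 1) * y 1 ^ 2 + 2 * algebraMap ℂ R (w 0) * y 1 * y 2) +
    6 * y 0 * (algebraMap ℂ R (w 0) * y 3 + algebraMap ℂ R (w 1) * y 2 +
      algebraMap ℂ R (w 2) * y 1) + y 0 ^ 2 * algebraMap ℂ R (w 3))

-- At most three of the six factors can contribute a positive power of `t` to `t³`, so `y₀³` splits
-- off. The proof writes the factor as `y₀ + tE` and expands in powers of `tE`.
open Polynomial in
theorem coeff_three_mul_pow_six {R : Type*} [CommRing R] [Algebra ℂ R] (W : Polynomial ℂ) (y : ℕ →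
    R) :
    (W.map (algebraMap ℂ R) *
      (Polynomial.C (y 0) + Polynomial.C (y 1) * Polynomial.X + Polynomial.C (y 2) *
          Polynomial.X ^ 2 + Polynomial.C (y 3) * Polynomial.X ^ 3) ^ 6).coeff 3 =
      y 0 ^ 3 * extraCubic W.coeff y := by
  obtain ⟨V, hV⟩ : ∃ V, V = W.map (algebraMap ℂ R) := ⟨_, rfl⟩
  obtain ⟨E, hE⟩ : ∃ E, E = Polynomial.C (y 1) + Polynomial.C (y 2) * Polynomial.X +
      Polynomial.C (y 3) * Polynomial.X ^ 2 := ⟨_, rfl⟩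
  have h : V * (Polynomial.C (y 0) + Polynomial.C (y 1) * Polynomial.X + Polynomial.C (y 2) *
      Polynomial.X ^ 2 + Polynomial.C (y 3) * Polynomial.X ^ 3) ^ 6 =
      Polynomial.C (y 0 ^ 6) * V + Polynomial.C (6 * y 0 ^ 5) * (V * E) * Polynomial.X ^ 1 +
          Polynomial.C (15 * y 0 ^ 4) * (V * E ^ 2) * Polynomial.X ^ 2 +
        Polynomial.C (20 * y 0 ^ 3) * (V * E ^ 3) * Polynomial.X ^ 3 +
        V * (15 * Polynomial.C (y 0) ^ 2 * E ^ 4 + 6 * Polynomial.C (y 0) * Polynomial.X * E ^ 5 +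
            Polynomial.X ^ 2 * E ^ 6) * Polynomial.X ^ 4 := by
    rw [hE]
    simp only [map_mul, map_pow, map_ofNat]
    ring
  have e0 : E.coeff 0 = y 1 := by simp [hE]
  have e1 : E.coeff 1 = y 2 := by simp [hE, Polynomial.coeff_C]
  have e2 : E.coeff 2 = y 3 := by simp [hE]
  have v : ∀ k, V.coeff k = algebraMap ℂ R (W.coeff k) := fun k => by rw [hV, Polynomial.coeff_map]
  have c2 : (V * E).coeff 2 = V.coeff 0 * E.coeff 2 + V.coeff 1 * E.coeff 1 +
      V.coeff 2 * E.coeff 0 := by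
    rw [Polynomial.coeff_mul, Finset.Nat.sum_antidiagonal_eq_sum_range_succ_mk]
    simp [Finset.sum_range_succ]
  have c1 : (V * E ^ 2).coeff 1 = V.coeff 1 * E.coeff 0 ^ 2 +
      2 * V.coeff 0 * E.coeff 0 * E.coeff 1 := by
    rw [sq, Polynomial.mul_coeff_one, Polynomial.mul_coeff_one, Polynomial.mul_coeff_zero]
    ring
  have c0 : (E ^ 3).coeff 0 = E.coeff 0 ^ 3 := by
    simp only [Polynomial.mul_coeff_zero, pow_succ, pow_zero, one_mul]
  rw [← hV, h]
  simp only [Polynomial.coeff_add, Polynomial.coeff_mul_X_pow', Polynomial.coeff_C_mul]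
  norm_num
  rw [c0, c1, c2]
  simp only [e0, e1, e2, v, extraCubic]
  ring

open Polynomial in
/-- In a `ℂ`-algebra with elements `ξᵢ` such that `ξᵢ³ = 0` and `∑ bᵢ ξᵢ = 0`, the form `∑ ξᵢ`
satisfies the relation `(∑ ξᵢ)³ g = 0`. -/
theorem pow_three_mul_extraCubic_eq_zero {R : Type*} [CommRing R] [Algebra ℂ R] {b : Fin 7 → ℂ}
    (hb : Function.Injective b) (hb0 : ∀ i, b i ≠ 0) {ξ : Fin 7 → R} (hξ : ∀ i, ξ i ^ 3 = 0)
    (hl : ∑ i, algebraMap ℂ R (b i) * ξ i = 0) {y : ℕ → R}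
    (hy : ∀ k, y k = ∑ i, algebraMap ℂ R ((b i)⁻¹ ^ k) * ξ i) :
    y 0 ^ 3 * extraCubic (nodePoly b ^ 2).coeff y = 0 := by
  nontriviality R
  let p : Fin 7 → Polynomial R := fun i => Polynomial.X - Polynomial.C (algebraMap ℂ R (b i))
  have hω : (nodePoly b).map (algebraMap ℂ R) = ∏ i, p i := by
    simp [p, Polynomial.map_prod]
  have hunit : ∀ c : ℂ, c ≠ 0 → IsUnit (Polynomial.C (algebraMap ℂ R c)) := fun c hc =>
    ((isUnit_iff_ne_zero.2 hc).map (algebraMap ℂ R)).map Polynomial.C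
  have hcop : Pairwise fun i j => IsCoprime (p i) (p j) := by
    intro i j hij
    obtain ⟨u, hu⟩ := hunit (b j - b i) (sub_ne_zero.2 fun h => hij (hb h.symm))
    refine ⟨↑u⁻¹, -↑u⁻¹, ?_⟩
    have : p i - p j = u := by simp [p, hu]
    rw [neg_mul, ← sub_eq_add_neg, ← mul_sub, this, Units.inv_mul]
  -- The sum of the `γ i` is `ω ∑ bᵢξᵢ/(t - bᵢ)`, where `ω = ∏ (t - bᵢ)`.
  let γ : Fin 7 → Polynomial R := fun i =>
    Polynomial.C (algebraMap ℂ R (b i) * ξ i) * ∏ j ∈ Finset.univ.erase i, p j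
  have hdvd : (∏ i, p i) ^ 4 ∣ (∑ i, γ i) ^ 6 := by
    refine prod_pow_four_dvd_sum_pow_six hcop (fun i => ?_) fun i j hij => ?_
    · simp only [γ]
      rw [mul_pow, ← Polynomial.C_pow, mul_pow, hξ, mul_zero, Polynomial.C_0, zero_mul]
    · exact (Finset.dvd_prod_of_mem p (Finset.mem_erase.2 ⟨hij, Finset.mem_univ i⟩)).mul_left _
  obtain ⟨F, hF⟩ := hdvd
  have hmon : ∀ i, (p i).Monic := fun i => Polynomial.monic_X_sub_C _
  have hdeg : ∀ i, (∏ j ∈ Finset.univ.erase i, p j).natDegree = 6 := by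
    intro i
    rw [natDegree_prod_of_monic _ _ fun j _ => hmon j]
    simp [p]
  -- The coefficient of `t⁶` is `∑ bᵢξᵢ = 0`. This drop in degree is where the linear relation
  -- enters.
  have hγdeg : (∑ i, γ i).natDegree ≤ 5 := by
    rw [natDegree_le_iff_coeff_eq_zero]
    intro N hN
    rcases (by omega : N = 6 ∨ 6 < N) with rfl | hN
    · rw [finsetSum_coeff, ← hl]
      refine Finset.sum_congr rfl fun i _ => ?_
      have := monic_prod_of_monic (Finset.univ.erase i) p fun j _ => hmon j
      rw [Monic, leadingCoeff, hdeg] at this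
      rw [Polynomial.coeff_C_mul, this, mul_one]
    · rw [finsetSum_coeff]
      refine Finset.sum_eq_zero fun i _ => ?_
      rw [Polynomial.coeff_C_mul, coeff_eq_zero_of_natDegree_lt (by rw [hdeg]; exact hN), mul_zero]
  have hF3 : F.coeff 3 = 0 := by
    by_cases hF0 : F = 0
    · rw [hF0, Polynomial.coeff_zero]
    apply coeff_eq_zero_of_natDegree_lt
    have hm : ((∏ i, p i) ^ 4).Monic := (monic_prod_of_monic _ _ fun i _ => hmon i).pow 4
    have h1 := hm.natDegree_mul' hF0
    rw [← hF, (monic_prod_of_monic _ _ fun i _ => hmon i).natDegree_pow,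
      natDegree_prod_of_monic _ _ fun i _ => hmon i] at h1
    have h2 : ((∑ i, γ i) ^ 6).natDegree ≤ 30 := natDegree_pow_le_of_le 6 hγdeg
    have h3 : ∑ i : Fin 7, (p i).natDegree = 7 := by simp [p]
    omega
  obtain ⟨Y, hY⟩ : ∃ Y, Y = Polynomial.C (y 0) + Polynomial.C (y 1) * Polynomial.X +
      Polynomial.C (y 2) * Polynomial.X ^ 2 + Polynomial.C (y 3) * Polynomial.X ^ 3 := ⟨_, rfl⟩
  -- This is the geometric series `bᵢ/(t - bᵢ) = -∑ₖ bᵢ⁻ᵏtᵏ`, truncated modulo `t⁴`.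
  have hγY : Polynomial.X ^ 4 ∣ (∑ i, γ i) - -((∏ i, p i) * Y) := by
    have hYs : Y = ∑ i, Polynomial.C (ξ i) * (1 + Polynomial.C (algebraMap ℂ R (b i)⁻¹) *
        Polynomial.X +
        Polynomial.C (algebraMap ℂ R ((b i)⁻¹ ^ 2)) * Polynomial.X ^ 2 +
            Polynomial.C (algebraMap ℂ R ((b i)⁻¹ ^ 3)) * Polynomial.X ^ 3) := by
      simp only [hY, hy, map_sum, map_mul, Finset.sum_mul, ← Finset.sum_add_distrib]
      refine Finset.sum_congr rfl fun i _ => ?_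
      simp only [pow_zero, pow_one, map_one]
      ring
    rw [sub_neg_eq_add, hYs, Finset.mul_sum, ← Finset.sum_add_distrib]
    refine Finset.dvd_sum fun i _ => ?_
    rw [← Finset.mul_prod_erase _ p (Finset.mem_univ i)]
    refine ⟨(∏ j ∈ Finset.univ.erase i, p j) * Polynomial.C (ξ i) *
        Polynomial.C (algebraMap ℂ R ((b i)⁻¹ ^ 3)), ?_⟩
    have hbb : Polynomial.C (algebraMap ℂ R (b i)) * Polynomial.C (algebraMap ℂ R (b i)⁻¹) = 1 := by
      rw [← Polynomial.C_mul, ← map_mul, mul_inv_cancel₀ (hb0 i), map_one, Polynomial.C_1]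
    simp only [γ, p, map_mul, map_pow]
    set u := Polynomial.C (algebraMap ℂ R (b i))
    set v := Polynomial.C (algebraMap ℂ R (b i)⁻¹)
    linear_combination -(∏ j ∈ Finset.univ.erase i,
        (Polynomial.X - Polynomial.C (algebraMap ℂ R (b j)))) * Polynomial.C (ξ i) *
      (Polynomial.X + v * Polynomial.X ^ 2 + v ^ 2 * Polynomial.X ^ 3) * hbb
  -- Comparing `γ⁶ = ω⁴F` with `γ⁶ ≡ ω⁶Y⁶` modulo `t⁴`; as `ω` is coprime to `t`, cancelling `ω⁴`
  -- leaves `F ≡ ω²Y⁶`.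
  have hdiv : Polynomial.X ^ 4 ∣ (∏ i, p i) ^ 4 * ((∏ i, p i) ^ 2 * Y ^ 6 - F) := by
    have h6 := hγY.trans (sub_dvd_pow_sub_pow _ _ 6)
    rw [hF, Even.neg_pow (by decide)] at h6
    rw [← dvd_neg]
    convert h6 using 1
    ring
  have hXω : IsCoprime (Polynomial.X ^ 4) ((∏ i, p i) ^ 4) := by
    suffices h : IsCoprime (Polynomial.X : Polynomial R) (∏ i, p i) from h.pow
    refine IsCoprime.prod_right fun i _ => ?_
    obtain ⟨u, hu⟩ := hunit (b i) (hb0 i)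
    refine ⟨↑u⁻¹, -↑u⁻¹, ?_⟩
    have : (Polynomial.X : Polynomial R) - p i = u := by simp [p, hu]
    rw [neg_mul, ← sub_eq_add_neg, ← mul_sub, this, Units.inv_mul]
  have hfin := (Polynomial.X_pow_dvd_iff.1 (hXω.dvd_of_dvd_mul_left hdiv)) 3 (by norm_num)
  rw [Polynomial.coeff_sub, hF3, sub_zero, ← hω, ← Polynomial.map_pow, hY,
    coeff_three_mul_pow_six] at hfin
  exact hfin

theorem linearForm_isHomogeneous {n : ℕ} (a : Fin n → ℂ) : (linearForm a).IsHomogeneous 1 :=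
  linearForm_mem a

theorem map_extraCubic {R R' : Type*} [CommRing R] [Algebra ℂ R] [CommRing R'] [Algebra ℂ R']
    (φ : R →ₐ[ℂ] R') (w : ℕ → ℂ) (y : ℕ → R) :
    φ (extraCubic w y) = extraCubic w fun k => φ (y k) := by
  have h20 : φ 20 = 20 := map_ofNat φ 20
  have h15 : φ 15 = 15 := map_ofNat φ 15
  have h6 : φ 6 = 6 := map_ofNat φ 6
  have h2 : φ 2 = 2 := map_ofNat φ 2
  simp only [extraCubic, map_add, map_mul, map_pow, AlgHom.commutes, h20, h15, h6, h2]

theorem extraCubic_isHomogeneous {σ : Type*} (w : ℕ → ℂ) {y : ℕ → MvPolynomial σ ℂ}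
    (hy : ∀ k, (y k).IsHomogeneous 1) : (extraCubic w y).IsHomogeneous 3 := by
  have hc : ∀ c : ℂ, (C c : MvPolynomial σ ℂ).IsHomogeneous 0 := isHomogeneous_C σ
  have hN : ∀ N : ℕ, (N : MvPolynomial σ ℂ).IsHomogeneous 0 := fun N => by
    rw [← map_natCast C N]
    exact hc _
  have h2 := hN 2
  have h6 := hN 6
  have h15 := hN 15
  have h20 := hN 20
  push_cast at h2 h6 h15 h20
  have hpow : ∀ (k m : ℕ), (y k ^ m).IsHomogeneous m := fun k m => by
    simpa using (hy k).pow m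
  have e1 : (C (w 0) * y 3 + C (w 1) * y 2 + C (w 2) * y 1).IsHomogeneous 1 :=
    (((hy 3).C_mul _).add ((hy 2).C_mul _)).add ((hy 1).C_mul _)
  have e2 : (C (w 1) * y 1 ^ 2 + 2 * C (w 0) * y 1 * y 2).IsHomogeneous 2 :=
    ((hpow 1 2).C_mul _).add (((h2.mul (hc (w 0))).mul (hy 1)).mul (hy 2))
  have t1 := (h20.mul (hc (w 0))).mul (hpow 1 3)
  have t2 := (hy 0).mul (((h15.mul e2).add ((h6.mul (hy 0)).mul e1)).add
    ((hpow 0 2).mul (hc (w 3))))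
  exact t1.add t2

/-- The coefficient vectors of the linear forms `∑ bᵢ⁻ᵏ xᵢ`. -/
noncomputable abbrev invPowers {m : ℕ} (b : Fin m → ℂ) (k : ℕ) : Fin m → ℂ := fun i => (b i)⁻¹ ^ k

theorem linearForm_one (n : ℕ) : linearForm (1 : Fin n → ℂ) = ∑ i, X i := by
  simp [linearForm]

/-- The extra relation lifts to the polynomial ring. -/
theorem exists_extraCubic_relation {b : Fin 7 → ℂ} (hb : Function.Injective b)
    (hb0 : ∀ i, b i ≠ 0) : ∃ f : MvPolynomial (Fin 7) ℂ, f.IsHomogeneous 5 ∧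
      (∑ i, X i) ^ 3 * extraCubic (nodePoly b ^ 2).coeff (fun k => linearForm (invPowers b k)) -
        linearForm b * f ∈ varCubes 7 := by
  obtain ⟨g, hg⟩ : ∃ g, g =
    extraCubic (nodePoly b ^ 2).coeff (fun k => linearForm (invPowers b k)) := ⟨_, rfl⟩
  let I := varCubes 7 ⊔ Ideal.span {linearForm b}
  have hX : ∀ i : Fin 7, Ideal.Quotient.mkₐ ℂ I (X i) ^ 3 = 0 := fun i => by
    rw [← map_pow, Ideal.Quotient.mkₐ_eq_mk, Ideal.Quotient.eq_zero_iff_mem]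
    exact Ideal.mem_sup_left (X_pow_three_mem_varCubes i)
  have hlin : ∀ a : Fin 7 → ℂ, Ideal.Quotient.mkₐ ℂ I (linearForm a) =
      ∑ i, algebraMap ℂ _ (a i) * Ideal.Quotient.mkₐ ℂ I (X i) := fun a => by
    simp only [linearForm, map_sum, map_mul]
    refine Finset.sum_congr rfl fun i _ => ?_
    rw [← algebraMap_eq, AlgHom.commutes]
  have hl : ∑ i, algebraMap ℂ _ (b i) * Ideal.Quotient.mkₐ ℂ I (X i) = 0 := by
    rw [← hlin, Ideal.Quotient.mkₐ_eq_mk, Ideal.Quotient.eq_zero_iff_mem]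
    exact Ideal.mem_sup_right (Ideal.mem_span_singleton_self _)
  have key := pow_three_mul_extraCubic_eq_zero hb hb0 hX hl
    (y := fun k => Ideal.Quotient.mkₐ ℂ I (linearForm (invPowers b k))) fun k => hlin _
  rw [← map_extraCubic, ← map_pow, ← map_mul, Ideal.Quotient.mkₐ_eq_mk,
    Ideal.Quotient.eq_zero_iff_mem, ← hg] at key
  have hy0 : linearForm (invPowers b 0) = ∑ i, X i := by
    rw [← linearForm_one]
    exact congrArg linearForm (funext fun i => pow_zero _)
  rw [hy0] at key
  obtain ⟨j, hj, r, hr, hjr⟩ := Submodule.mem_sup.1 key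
  obtain ⟨h, rfl⟩ := Ideal.mem_span_range_iff_exists_fun.1 hj
  obtain ⟨f, rfl⟩ := Ideal.mem_span_singleton'.1 hr
  have hs : ((∑ i, X i : MvPolynomial (Fin 7) ℂ) ^ 3).IsHomogeneous 3 := by
    rw [← linearForm_one]
    exact (linearForm_isHomogeneous _).pow 3
  have hg3 : g.IsHomogeneous 3 :=
      hg ▸ extraCubic_isHomogeneous _ fun k => linearForm_isHomogeneous _
  refine ⟨homogeneousComponent 5 f, homogeneousComponent_isHomogeneous _ _, ?_⟩
  have := congrArg (homogeneousComponent 6) hjr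
  rw [homogeneousComponent_of_mem (hs.mul hg3), if_pos rfl, map_add, map_sum,
    homogeneousComponent_mul_of_isHomogeneous (linearForm_isHomogeneous b) 5] at this
  rw [← hg, ← this, mul_comm (linearForm b), add_sub_cancel_right]
  refine Ideal.sum_mem _ fun i _ => ?_
  rw [homogeneousComponent_mul_of_isHomogeneous ((isHomogeneous_X ℂ i).pow 3) 3]
  exact Ideal.mul_mem_left _ _ (X_pow_three_mem_varCubes i)

/-- A vector with nonzero coordinates on which the forms `∑ bᵢ⁻ᵏ xᵢ`, `-1 ≤ k ≤ 3`, vanish. -/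
theorem exists_annihilated_by_powers {b : Fin 7 → ℂ} (hb : Function.Injective b)
    (hb0 : ∀ i, b i ≠ 0) : ∃ d : Fin 7 → ℂ, (∀ i, d i ≠ 0) ∧ ∑ i, b i * d i = 0 ∧
      ∀ k ≤ 3, ∑ i, invPowers b k i * d i = 0 := by
  -- The sum is the `t⁶` coefficient of the Lagrange interpolant of `tᵐ` at seven nodes, which is
  -- `tᵐ` itself.
  have hsum : ∀ m < 6, ∑ i, b i ^ m / ∏ j ∈ Finset.univ.erase i, (b i - b j) = 0 := by
    intro m hm
    have := Lagrange.coeff_eq_sum (s := Finset.univ) (v := b) hb.injOn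
      (P := Polynomial.X ^ m) (by
        rw [Polynomial.degree_X_pow, Finset.card_univ, Fintype.card_fin]
        exact_mod_cast (by omega : m < 7))
    rw [Polynomial.coeff_X_pow, Finset.card_univ, Fintype.card_fin, if_neg (by omega)] at this
    simpa using this.symm
  -- The factor `bᵢ³` moves the required exponents `-3, …, 1` to `0, …, 4`, all below 6.
  refine ⟨fun i => b i ^ 3 / ∏ j ∈ Finset.univ.erase i, (b i - b j), fun i => ?_, ?_, ?_⟩
  · refine div_ne_zero (pow_ne_zero _ (hb0 i)) (Finset.prod_ne_zero_iff.2 fun j hj => ?_)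
    exact sub_ne_zero.2 fun h => Finset.ne_of_mem_erase hj (hb h).symm
  · rw [← hsum 4 (by norm_num)]
    exact Finset.sum_congr rfl fun i _ => by ring
  · intro k hk
    rw [← hsum (3 - k) (by omega)]
    refine Finset.sum_congr rfl fun i _ => ?_
    have : (b i)⁻¹ ^ k * b i ^ 3 = b i ^ (3 - k) := by
      rw [pow_sub₀ _ (hb0 i) hk, inv_pow, mul_comm]
    rw [← this]
    ring

/-- The extra cubic is not a combination of the cubes of the variables and of the multiples of
`∑ bᵢ xᵢ`. -/
theorem extraCubic_ne {b : Fin 7 → ℂ} (hb : Function.Injective b) (hb0 : ∀ i, b i ≠ 0)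
    {r : MvPolynomial (Fin 7) ℂ} (hr : r.IsHomogeneous 2) (c : Fin 7 → ℂ) :
    extraCubic (nodePoly b ^ 2).coeff (fun k => linearForm (invPowers b k)) ≠
      linearForm b * r + ∑ i, C (c i) * X i ^ 3 := by
  intro h
  obtain ⟨d, hd, hbd, hyd⟩ := exists_annihilated_by_powers hb hb0
  -- The derivative along `d` kills `ℓ = ∑ bᵢxᵢ` and all the forms of which `g` is a polynomial.
  -- Applied to the supposed identity it leaves `ℓ · Dr + 3 ∑ cᵢdᵢxᵢ² = 0`.
  have hD : ∃ D : Derivation ℂ (MvPolynomial (Fin 7) ℂ) (MvPolynomial (Fin 7) ℂ),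
      ∀ f, D f = ∑ i, C (d i) * pderiv i f := by
    refine ⟨∑ i, d i • pderiv i, fun f => ?_⟩
    rw [← Derivation.coeFnAddMonoidHom_apply, map_sum, Finset.sum_apply]
    simp [C_mul']
  obtain ⟨D, hD⟩ := hD
  have hDlin : ∀ a, D (linearForm a) = C (∑ i, a i * d i) := by
    intro a
    simp only [hD, pderiv_linearForm, map_sum, ← C_mul, mul_comm]
  have hDg : D (extraCubic (nodePoly b ^ 2).coeff (fun k => linearForm (invPowers b k))) = 0 := by
    have hy : ∀ k ≤ 3, D (linearForm (invPowers b k)) = 0 := fun k hk => by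
      rw [hDlin, hyd k hk, C_0]
    have h20 : D 20 = 0 := D.map_natCast 20
    have h15 : D 15 = 0 := D.map_natCast 15
    have h6 : D 6 = 0 := D.map_natCast 6
    have h2 : D 2 = 0 := D.map_natCast 2
    simp only [extraCubic, map_add, Derivation.leibniz, Derivation.leibniz_pow,
      Derivation.map_algebraMap, hy 0 (by norm_num), hy 1 (by norm_num), hy 2 (by norm_num),
      hy 3 le_rfl, h20, h15, h6, h2, smul_zero, add_zero]
  have hDr : ∃ q, D r = linearForm q := by
    apply IsHomogeneous.exists_eq_linearForm
    rw [hD]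
    exact IsHomogeneous.sum _ _ _ fun i _ => hr.pderiv.C_mul _
  obtain ⟨q, hq⟩ := hDr
  have hDc : linearForm b * linearForm q + ∑ i, C (3 * c i * d i) * X i ^ 2 = 0 := by
    have hX : ∀ i, D (X i) = C (d i) := by
      intro i
      rw [hD]
      simp [pderiv_X, Pi.single_apply]
    have := congrArg D h
    rw [hDg, map_add, map_sum, Derivation.leibniz, hDlin, hbd, C_0, smul_zero, add_zero, hq] at this
    rw [smul_eq_mul] at this
    rw [this]
    refine congrArg (linearForm b * linearForm q + ·) (Finset.sum_congr rfl fun i _ => ?_)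
    have hDC : D (C (c i) * X i ^ 3) = C (c i) * D (X i ^ 3) := by
      rw [C_mul', D.map_smul, C_mul']
    rw [hDC, Derivation.leibniz_pow, hX, C_mul, C_mul]
    simp only [smul_eq_mul, nsmul_eq_mul]
    rw [show (C 3 : MvPolynomial (Fin 7) ℂ) = 3 from map_ofNat C 3]
    push_cast
    ring
  have hpd : ∀ i j, b i * q j + b j * q i + (if i = j then 6 * c i * d i else 0) = 0 := by
    intro i j
    have h1 : pderiv i (∑ i, C (3 * c i * d i) * X i ^ 2) = C (6 * c i * d i) * X i := by
      rw [map_sum, Finset.sum_eq_single i]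
      · rw [pderiv_C_mul, pderiv_pow, pderiv_X_self, show 6 * c i * d i = 2 * (3 * c i *
          d i) by ring,
          C_mul (a := 2), show (C 2 : MvPolynomial (Fin 7) ℂ) = 2 from map_ofNat C 2]
        push_cast
        ring
      · intro k _ hk
        rw [pderiv_C_mul, pderiv_pow, pderiv_X_of_ne hk, mul_zero, mul_zero]
      · exact fun h => absurd (Finset.mem_univ i) h
    have h2 := congrArg (fun f => pderiv j (pderiv i f)) hDc
    simp only [map_add, h1, pderiv_mul, pderiv_linearForm, pderiv_C, map_zero, mul_zero, zero_mul,
      zero_add, add_zero] at h2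
    by_cases hij : i = j
    · subst hij
      rw [pderiv_X_self, mul_one, ← C_mul, ← C_add, ← C_add, ← C_0] at h2
      rw [if_pos rfl]
      linear_combination C_injective _ _ h2
    · rw [pderiv_X_of_ne hij, mul_zero, add_zero, ← C_mul, ← C_mul, ← C_add, ← C_0] at h2
      rw [if_neg hij]
      linear_combination C_injective _ _ h2
  -- A product `ℓq` without mixed terms, where all coefficients of `ℓ` are nonzero, vanishes: three
  -- off-diagonal equations determine `q i`.
  have hq0 : ∀ i, q i = 0 := by
    intro i
    obtain ⟨j, k, hij, hik, hjk⟩ : ∃ j k, i ≠ j ∧ i ≠ k ∧ j ≠ k := by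
      revert i
      decide
    have e1 := hpd i j
    have e2 := hpd i k
    have e3 := hpd j k
    rw [if_neg hij] at e1
    rw [if_neg hik] at e2
    rw [if_neg hjk] at e3
    have : 2 * b j * b k * q i = 0 := by
      linear_combination b k * e1 + b j * e2 - b i * e3
    simpa [hb0] using this
  have hc : ∀ i, c i = 0 := by
    intro i
    have := hpd i i
    rw [if_pos rfl, hq0] at this
    simpa [hd] using this
  -- The first three coordinates are the cross product of `(b₀, b₁, b₂)` and `(1, 1, 1)`. So `ℓ` and
  -- `y₀` vanish at `z`, while `y₁` is a nonzero Vandermonde quotient; there `g = 20 w₀ y₁³ ≠ 0`,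
  -- but `ℓr = 0`.
  let z : Fin 7 → ℂ := ![b 1 - b 2, b 2 - b 0, b 0 - b 1, 0, 0, 0, 0]
  have hz : ∀ a : Fin 7 → ℂ, eval z (linearForm a) =
      a 0 * (b 1 - b 2) + a 1 * (b 2 - b 0) + a 2 * (b 0 - b 1) := by
    intro a
    rw [eval_linearForm, Fin.sum_univ_seven]
    simp [z]
  have h1 := congrArg (aeval z) h
  rw [map_extraCubic] at h1
  simp only [aeval_eq_eval, hc, map_zero, zero_mul, Finset.sum_const_zero, add_zero, map_mul,
    hz] at h1
  have h0 : ∏ i, -b i ≠ 0 := Finset.prod_ne_zero_iff.2 fun i _ => neg_ne_zero.2 (hb0 i)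
  have hw : (nodePoly b ^ 2).coeff 0 = (∏ i, -b i) ^ 2 := by
    rw [Polynomial.coeff_zero_eq_eval_zero, Polynomial.eval_pow, Polynomial.eval_prod]
    simp
  have hne : (b 0)⁻¹ * (b 1 - b 2) + (b 1)⁻¹ * (b 2 - b 0) + (b 2)⁻¹ * (b 0 - b 1) ≠ 0 := by
    have e : (b 0)⁻¹ * (b 1 - b 2) + (b 1)⁻¹ * (b 2 - b 0) + (b 2)⁻¹ * (b 0 - b 1) =
        (b 0 - b 1) * (b 1 - b 2) * (b 0 - b 2) / (b 0 * b 1 * b 2) := by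
      have := hb0 0
      have := hb0 1
      have := hb0 2
      field_simp
      ring
    rw [e]
    have hsub : ∀ i j, i ≠ j → b i - b j ≠ 0 := fun i j hij => sub_ne_zero.2 fun h => hij (hb h)
    exact div_ne_zero (mul_ne_zero (mul_ne_zero (hsub 0 1 (by decide)) (hsub 1 2 (by decide)))
      (hsub 0 2 (by decide))) (mul_ne_zero (mul_ne_zero (hb0 0) (hb0 1)) (hb0 2))
  have hbz : b 0 * (b 1 - b 2) + b 1 * (b 2 - b 0) + b 2 * (b 0 - b 1) = 0 := by ring
  rw [hbz, zero_mul, extraCubic, hw] at h1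
  simp only [invPowers, pow_zero, pow_one, one_mul, sub_add_sub_cancel, sub_self, zero_mul,
    add_zero] at h1
  refine mul_ne_zero (mul_ne_zero (by norm_num) ?_) (pow_ne_zero 3 hne) h1
  exact pow_ne_zero 2 h0

/-! ### Multiplication by linear forms -/

instance {n : ℕ} (I : Ideal (MvPolynomial (Fin n) ℂ)) (i : ℕ) :
    FiniteDimensional ℂ (gradedPiece I i) :=
  inferInstanceAs (FiniteDimensional ℂ
    ((homogeneousSubmodule (Fin n) ℂ i).map (Ideal.Quotient.mkₐ ℂ I).toLinearMap))

theorem mulMap_injective_iff {n : ℕ} {I : Ideal (MvPolynomial (Fin n) ℂ)} {i : ℕ}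
    {b : Fin n → ℂ} : Function.Injective (mulMap I i b) ↔
      ∀ f : MvPolynomial (Fin n) ℂ, f.IsHomogeneous i → linearForm b * f ∈ I → f ∈ I := by
  rw [injective_iff_map_eq_zero]
  constructor
  · intro h f hf hlf
    have := h ⟨Ideal.Quotient.mk I f, f, hf, rfl⟩ (Subtype.ext ?_)
    · exact Ideal.Quotient.eq_zero_iff_mem.1 (congrArg Subtype.val this)
    · change Ideal.Quotient.mk I (linearForm b) * Ideal.Quotient.mk I f = 0
      rw [← map_mul]
      exact Ideal.Quotient.eq_zero_iff_mem.2 hlf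
  · rintro h ⟨_, f, hf, rfl⟩ hx
    have hx' : Ideal.Quotient.mk I (linearForm b) * Ideal.Quotient.mk I f = 0 :=
      congrArg Subtype.val hx
    rw [← map_mul] at hx'
    exact Subtype.ext (Ideal.Quotient.eq_zero_iff_mem.2
      (h f hf (Ideal.Quotient.eq_zero_iff_mem.1 hx')))

theorem mulMap_eq_sum {n : ℕ} (I : Ideal (MvPolynomial (Fin n) ℂ)) (i : ℕ) (b : Fin n → ℂ) :
    mulMap I i b = ∑ j, b j • mulMap I i (Pi.single j 1) := by
  ext x
  have hs : ∀ j : Fin n, linearForm (Pi.single j 1) = X j := by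
    intro j
    simp [linearForm, Pi.single_apply]
  have hb : Ideal.Quotient.mk I (linearForm b) =
      ∑ j, b j • Ideal.Quotient.mk I (linearForm (Pi.single j 1)) := by
    simp only [hs]
    rw [linearForm, map_sum]
    simp only [C_mul']
    rfl
  rw [LinearMap.sum_apply, AddSubmonoidClass.coe_finsetSum]
  change Ideal.Quotient.mk I (linearForm b) * x.1 = ∑ j, b j •
    (Ideal.Quotient.mk I (linearForm (Pi.single j 1)) * x.1)
  rw [hb, Finset.sum_mul]
  exact Finset.sum_congr rfl fun j _ => smul_mul_assoc _ _ _

/-- Injectivity of the multiplication by a linear form is an open condition on the form. -/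
theorem exists_eval_ne_zero_imp_mulMap_injective {n : ℕ} {I : Ideal (MvPolynomial (Fin n) ℂ)}
    {i : ℕ} {b₀ : Fin n → ℂ} (h : Function.Injective (mulMap I i b₀)) :
    ∃ P : MvPolynomial (Fin n) ℂ, eval b₀ P ≠ 0 ∧
      ∀ b, eval b P ≠ 0 → Function.Injective (mulMap I i b) := by
  let v := Module.finBasis ℂ (gradedPiece I i)
  let w := Module.finBasis ℂ (gradedPiece I (i + 1))
  let M := ∑ j, (X j : MvPolynomial (Fin n) ℂ) •
    (LinearMap.toMatrix v w (mulMap I i (Pi.single j 1))).map (C : ℂ → MvPolynomial (Fin n) ℂ)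
  have hM : ∀ b, M.map (eval b) = LinearMap.toMatrix v w (mulMap I i b) := by
    intro b
    rw [mulMap_eq_sum I i b, map_sum]
    ext k l
    simp [M, Matrix.sum_apply]
  have hinj : ∀ b, Function.Injective (M.map (eval b)).mulVec ↔
      Function.Injective (mulMap I i b) := by
    intro b
    rw [hM]
    have e : ⇑(mulMap I i b) =
        w.equivFun.symm ∘ (LinearMap.toMatrix v w (mulMap I i b)).mulVec ∘ v.equivFun := by
      ext1 x
      rw [Function.comp_apply, Function.comp_apply, LinearEquiv.eq_symm_apply]
      exact (LinearMap.toMatrix_mulVec_repr v w _ x).symm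
    rw [e, EquivLike.comp_injective, EquivLike.injective_comp]
  obtain ⟨P, hP, hPi⟩ := exists_eval_ne_zero_imp_mulVec_injective M b₀ ((hinj b₀).2 h)
  exact ⟨P, hP, fun b hb => (hinj b).1 (hPi b hb)⟩

/-! ### The normal form -/

/-- The coefficient vectors of the linear forms `x₁, …, x₇, x₁ + ⋯ + x₇`. -/
noncomputable def normalForms : Fin 8 → Fin 7 → ℂ :=
  Fin.snoc (α := fun _ => Fin 7 → ℂ) (fun i : Fin 7 => Pi.single i 1) 1

theorem linearForm_normalForms_castSucc (i : Fin 7) :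
    linearForm (normalForms i.castSucc) = X i := by
  simp [normalForms, linearForm, Pi.single_apply]

theorem linearForm_normalForms_last : linearForm (normalForms (Fin.last 7)) = ∑ i, X i := by
  rw [← linearForm_one, normalForms, Fin.snoc_last]

/-- Modulo the cubes of the variables only the last term survives, and `(∑ xᵢ)³` is injective on
quadrics there. What remains is a quadratic syzygy of the `xᵢ³`. -/
theorem eq_zero_of_sum_mul_normalForms {q : Fin 8 → MvPolynomial (Fin 7) ℂ}
    (hq : ∀ j, (q j).IsHomogeneous 2) (h : ∑ j, q j * linearForm (normalForms j) ^ 3 = 0) :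
    q = 0 := by
  rw [Fin.sum_univ_castSucc] at h
  simp only [linearForm_normalForms_castSucc, linearForm_normalForms_last] at h
  have hlast : q (Fin.last 7) = 0 := by
    refine eq_zero_of_mem_varCubes (by norm_num) (hq _)
      (mem_varCubes_of_sum_X_pow_three_mul_mem (by norm_num) (hq _) ?_)
    rw [mul_comm, eq_neg_of_add_eq_zero_right h]
    exact neg_mem (Ideal.sum_mem _ fun i _ => Ideal.mul_mem_left _ _ (X_pow_three_mem_varCubes i))
  rw [hlast, zero_mul, add_zero] at h
  have := eq_zero_of_sum_mul_X_pow_three (fun i => hq i.castSucc) h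
  ext1 j
  refine Fin.lastCases hlast (fun i => ?_) j
  exact congrFun this i

/-- The quintic `f` of the extra relation satisfies `ℓf ∈ I`. Membership `f ∈ I` would put `(∑
xᵢ)³(g - ℓr)` in the ideal of the cubes of the variables, hence `g - ℓr` as well, contradicting
`extraCubic_ne`. -/
theorem not_injective_mulMap_normalForms_of_injective {b : Fin 7 → ℂ} (hb : Function.Injective b)
    (hb0 : ∀ i, b i ≠ 0) : ¬ Function.Injective (mulMap (cubesIdeal normalForms) 5 b) := by
  rw [mulMap_injective_iff]
  intro h
  obtain ⟨f, hf, hrel⟩ := exists_extraCubic_relation hb hb0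
  have hle : varCubes 7 ≤ cubesIdeal normalForms := by
    rw [varCubes, Ideal.span_le]
    rintro _ ⟨i, rfl⟩
    refine Ideal.subset_span ⟨i.castSucc, ?_⟩
    simp only [linearForm_normalForms_castSucc]
  have hs : (∑ i, X i : MvPolynomial (Fin 7) ℂ) ^ 3 ∈ cubesIdeal normalForms :=
    Ideal.subset_span ⟨Fin.last 7, by simp only [linearForm_normalForms_last]⟩
  have hfI := h f hf (by
    have := sub_mem (Ideal.mul_mem_right
      (extraCubic (nodePoly b ^ 2).coeff fun k => linearForm (invPowers b k)) _ hs) (hle hrel)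
    rwa [sub_sub_cancel] at this)
  obtain ⟨g, hg⟩ := Ideal.mem_span_range_iff_exists_fun.1 hfI
  have hg2 := hf.eq_sum_homogeneousComponent_mul (k := 2)
    (fun j => (linearForm_isHomogeneous (normalForms j)).pow 3) hg
  rw [Fin.sum_univ_castSucc] at hg2
  simp only [linearForm_normalForms_castSucc, linearForm_normalForms_last] at hg2
  have hr := homogeneousComponent_isHomogeneous 2 (g (Fin.last 7))
  set r := homogeneousComponent 2 (g (Fin.last 7))
  have hhom : (extraCubic (nodePoly b ^ 2).coeff (fun k => linearForm (invPowers b k)) -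
      linearForm b * r).IsHomogeneous 3 :=
    (extraCubic_isHomogeneous _ fun k => linearForm_isHomogeneous _).sub
      ((linearForm_isHomogeneous b).mul hr)
  have hmem := mem_varCubes_of_sum_X_pow_three_mul_mem (by norm_num) hhom <| by
    have h2 : linearForm b * ∑ i : Fin 7, homogeneousComponent 2 (g i.castSucc) * X i ^ 3 ∈
        varCubes 7 := Ideal.mul_mem_left _ _
      (Ideal.sum_mem _ fun i _ => Ideal.mul_mem_left _ _ (X_pow_three_mem_varCubes i))
    convert add_mem hrel h2 using 1
    rw [← hg2]
    ring
  obtain ⟨c, hc⟩ := Ideal.mem_span_range_iff_exists_fun.1 hmem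
  have hc0 := IsHomogeneous.eq_sum_homogeneousComponent_mul (k := 0) (d := 3) hhom
    (fun i => (isHomogeneous_X ℂ i).pow 3) hc
  simp only [homogeneousComponent_zero] at hc0
  exact extraCubic_ne hb hb0 hr (fun i => coeff 0 (c i)) (by rw [hc0, add_sub_cancel])

/-- Injectivity for one form would hold on a nonempty open set, which meets the open set of forms
with distinct nonzero coefficients. -/
theorem not_injective_mulMap_normalForms (b : Fin 7 → ℂ) :
    ¬ Function.Injective (mulMap (cubesIdeal normalForms) 5 b) := by
  intro h
  obtain ⟨P, hP, hPi⟩ := exists_eval_ne_zero_imp_mulMap_injective h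
  have hP0 : P ≠ 0 := fun h0 => hP (by rw [h0, map_zero])
  obtain ⟨Q, hQ⟩ : ∃ Q : MvPolynomial (Fin 7) ℂ, Q = P * (∏ i, X i) *
    ∏ x : Fin 7 × Fin 7 with x.1 ≠ x.2, (X x.1 - X x.2) := ⟨_, rfl⟩
  have hQ0 : Q ≠ 0 := by
    rw [hQ]
    refine mul_ne_zero (mul_ne_zero hP0 (Finset.prod_ne_zero_iff.2 fun i _ => X_ne_zero i))
      (Finset.prod_ne_zero_iff.2 fun x hx => sub_ne_zero.2 fun h => ?_)
    exact (Finset.mem_filter.1 hx).2 (X_injective h)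
  obtain ⟨b', hb'⟩ : ∃ b', eval b' Q ≠ 0 := by
    by_contra! h0
    exact hQ0 (MvPolynomial.funext fun x => by rw [h0, map_zero])
  rw [hQ, map_mul, map_mul, map_prod, map_prod] at hb'
  have h1 := left_ne_zero_of_mul hb'
  have h2 := Finset.prod_ne_zero_iff.1 (right_ne_zero_of_mul hb')
  have h3 := Finset.prod_ne_zero_iff.1 (right_ne_zero_of_mul h1)
  refine not_injective_mulMap_normalForms_of_injective (b := b') (fun i j hij => ?_) (fun i => ?_)
    (hPi b' (left_ne_zero_of_mul h1))
  · by_contra hne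
    have := h2 (i, j) (Finset.mem_filter.2 ⟨Finset.mem_univ _, hne⟩)
    rw [map_sub, eval_X, eval_X] at this
    exact this (sub_eq_zero.2 hij)
  · simpa using h3 i (Finset.mem_univ i)

/-! ### Change of coordinates -/

/-- The substitution taking the linear form with coefficient vector `a` to the one with
coefficient vector `a ᵥ* M`. -/
noncomputable def substitution {n : ℕ} (M : Matrix (Fin n) (Fin n) ℂ) :
    MvPolynomial (Fin n) ℂ →ₐ[ℂ] MvPolynomial (Fin n) ℂ :=
  aeval fun i => linearForm (M i)

theorem substitution_linearForm {n : ℕ} (M : Matrix (Fin n) (Fin n) ℂ) (a : Fin n → ℂ) :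
    substitution M (linearForm a) = linearForm (Matrix.vecMul a M) := by
  simp only [substitution, linearForm, map_sum, map_mul, aeval_X, Matrix.vecMul, dotProduct,
    algHom_C, Finset.mul_sum, Finset.sum_mul, ← mul_assoc]
  rw [Finset.sum_comm]
  rfl

theorem substitution_substitution {n : ℕ} {M N : Matrix (Fin n) (Fin n) ℂ} (h : M * N = 1)
    (f : MvPolynomial (Fin n) ℂ) : substitution N (substitution M f) = f := by
  have : (substitution N).comp (substitution M) = AlgHom.id ℂ _ := by
    refine algHom_ext fun i => ?_
    have hX : substitution M (X i) = linearForm (M i) := aeval_X _ _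
    rw [AlgHom.comp_apply, hX, substitution_linearForm]
    have : Matrix.vecMul (M i) N = Pi.single i 1 := by
      ext j
      refine (congrFun (congrFun h i) j).trans ?_
      simp [Matrix.one_apply, Pi.single_apply, eq_comm]
    rw [this]
    simp [linearForm, Pi.single_apply]
  exact AlgHom.congr_fun this f

theorem substitution_isHomogeneous {n k : ℕ} (M : Matrix (Fin n) (Fin n) ℂ)
    {f : MvPolynomial (Fin n) ℂ} (hf : f.IsHomogeneous k) : (substitution M f).IsHomogeneous k := by
  have := hf.aeval (fun i => linearForm (M i)) fun i => linearForm_isHomogeneous (M i)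
  rwa [one_mul] at this

theorem linearForm_smul {n : ℕ} (c : ℂ) (a : Fin n → ℂ) :
    linearForm (c • a) = C c * linearForm a := by
  simp [linearForm, Finset.mul_sum, mul_assoc]

theorem substitution_mem_cubesIdeal {r n : ℕ} {a a' : Fin r → Fin n → ℂ} {e : Fin r → ℂ}
    {M : Matrix (Fin n) (Fin n) ℂ} (h : ∀ j, Matrix.vecMul (a j) M = e j • a' j)
    {f : MvPolynomial (Fin n) ℂ} (hf : f ∈ cubesIdeal a) :
    substitution M f ∈ cubesIdeal a' := by
  suffices cubesIdeal a ≤ (cubesIdeal a').comap (substitution M) from this hf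
  rw [cubesIdeal, Ideal.span_le]
  rintro _ ⟨j, rfl⟩
  rw [SetLike.mem_coe, Ideal.mem_comap, map_pow, substitution_linearForm, h, linearForm_smul,
    mul_pow]
  exact Ideal.mul_mem_left _ _ (Ideal.subset_span ⟨j, rfl⟩)

/-- Eight linear forms in seven variables in general position are, up to scalars, the forms
`x₁, …, x₇, x₁ + ⋯ + x₇` in suitable coordinates. -/
theorem exists_normalForms {a : Fin 8 → Fin 7 → ℂ} (ha : InGeneralPosition a) :
    ∃ (A B : Matrix (Fin 7) (Fin 7) ℂ) (e : Fin 8 → ℂ), A * B = 1 ∧ B * A = 1 ∧ (∀ j, e j ≠ 0) ∧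
      (∀ j, Matrix.vecMul (a j) B = e j • normalForms j) ∧
      ∀ j, Matrix.vecMul (normalForms j) A = (e j)⁻¹ • a j := by
  obtain ⟨d, hd0, hd⟩ : ∃ d : Fin 8 → ℂ, (∀ k, d k ≠ 0) ∧ ∑ k, d k • a k = 0 :=
    exists_relation_ne_zero fun k => ha (Fin.succAboveEmb k)
  -- The relation between the eight vectors is used to rescale the first seven so that they sum to
  -- the eighth.
  let A : Matrix (Fin 7) (Fin 7) ℂ :=
    Matrix.of fun i => (-(d i.castSucc / d (Fin.last 7))) • a i.castSucc
  let e : Fin 8 → ℂ := Fin.snoc (α := fun _ => ℂ)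
    (fun i => (-(d i.castSucc / d (Fin.last 7)))⁻¹) 1
  have hA : IsUnit A.det := by
    have : A.det = (∏ i : Fin 7, -(d i.castSucc / d (Fin.last 7))) *
        (Matrix.of fun i : Fin 7 => a i.castSucc).det := Matrix.det_mul_column _ _
    rw [this]
    exact isUnit_iff_ne_zero.2 (mul_ne_zero
      (Finset.prod_ne_zero_iff.2 fun i _ => neg_ne_zero.2 (div_ne_zero (hd0 _) (hd0 _)))
      (ha Fin.castSuccEmb))
  have he : ∀ j, e j ≠ 0 := by
    intro j
    refine Fin.lastCases ?_ (fun i => ?_) j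
    · simp only [e, Fin.snoc_last]
      exact one_ne_zero
    · simp [e, hd0]
  have hNA : ∀ j, Matrix.vecMul (normalForms j) A = (e j)⁻¹ • a j := by
    intro j
    refine Fin.lastCases ?_ (fun i => ?_) j
    · rw [Matrix.vecMul_eq_sum]
      rw [Fin.sum_univ_castSucc] at hd
      have h2 : a (Fin.last 7) = -(d (Fin.last 7))⁻¹ • ∑ i : Fin 7, d i.castSucc • a i.castSucc :=
          by
        rw [eq_neg_of_add_eq_zero_left hd, smul_neg, neg_smul, neg_neg, smul_smul,
          inv_mul_cancel₀ (hd0 _), one_smul]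
      simp only [normalForms, e, Fin.snoc_last, inv_one, one_smul, Pi.one_apply]
      rw [h2, Finset.smul_sum]
      refine Finset.sum_congr rfl fun i _ => ?_
      rw [smul_smul]
      change (-(d i.castSucc / d (Fin.last 7))) • a i.castSucc = _
      congr 1
      ring
    · simp only [normalForms, e, Fin.snoc_castSucc, inv_inv]
      rw [Matrix.single_one_vecMul]
      rfl
  refine ⟨A, A⁻¹, e, Matrix.mul_nonsing_inv A hA, Matrix.nonsing_inv_mul A hA, he, fun j => ?_, hNA⟩
  have : a j = e j • Matrix.vecMul (normalForms j) A := by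
    rw [hNA, smul_smul, mul_inv_cancel₀ (he j), one_smul]
  rw [this, Matrix.smul_vecMul, Matrix.vecMul_vecMul, Matrix.mul_nonsing_inv A hA,
      Matrix.vecMul_one]

theorem eq_zero_of_sum_mul_linearForm {a : Fin 8 → Fin 7 → ℂ} (ha : InGeneralPosition a)
    {q : Fin 8 → MvPolynomial (Fin 7) ℂ} (hq : ∀ j, (q j).IsHomogeneous 2)
    (h : ∑ j, q j * linearForm (a j) ^ 3 = 0) : q = 0 := by
  obtain ⟨A, B, e, hAB, hBA, he, haB, -⟩ := exists_normalForms ha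
  have h1 := congrArg (substitution B) h
  simp only [map_sum, map_mul, map_pow, map_zero, substitution_linearForm, haB, linearForm_smul,
    mul_pow, ← mul_assoc] at h1
  have h2 := eq_zero_of_sum_mul_normalForms (fun j => by
    have := (substitution_isHomogeneous B (hq j)).mul (isHomogeneous_C (Fin 7) (e j ^ 3))
    rwa [add_zero, map_pow] at this) h1
  ext1 j
  have h3 := congrFun h2 j
  rw [← map_pow] at h3
  have h4 := (mul_eq_zero.1 h3).resolve_right (by simpa using he j)
  rw [← substitution_substitution hBA (q j), h4, map_zero, Pi.zero_apply]

theorem not_injective_mulMap {a : Fin 8 → Fin 7 → ℂ} (ha : InGeneralPosition a) (b : Fin 7 → ℂ) :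
    ¬ Function.Injective (mulMap (cubesIdeal a) 5 b) := by
  obtain ⟨A, B, e, hAB, hBA, he, haB, hNA⟩ := exists_normalForms ha
  intro h
  refine not_injective_mulMap_normalForms (Matrix.vecMul b B) (mulMap_injective_iff.2 ?_)
  intro f hf hlf
  rw [← substitution_substitution hAB f]
  refine substitution_mem_cubesIdeal haB
    (mulMap_injective_iff.1 h _ (substitution_isHomogeneous A hf) ?_)
  have := substitution_mem_cubesIdeal hNA hlf
  rwa [map_mul, substitution_linearForm, Matrix.vecMul_vecMul, hBA, Matrix.vecMul_one] at this

/-! ### Dimensions -/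

/-- The map `(g₁, …, g_r) ↦ ∑ g_j L_j³` on tuples of forms of degree `k`. -/
noncomputable def cubesCombination {r n : ℕ} (a : Fin r → Fin n → ℂ) (k : ℕ) :
    (Fin r → homogeneousSubmodule (Fin n) ℂ k) →ₗ[ℂ] MvPolynomial (Fin n) ℂ :=
  ∑ j, LinearMap.mulRight ℂ (linearForm (a j) ^ 3) ∘ₗ Submodule.subtype _ ∘ₗ LinearMap.proj j

theorem cubesCombination_apply {r n : ℕ} (a : Fin r → Fin n → ℂ) (k : ℕ)
    (g : Fin r → homogeneousSubmodule (Fin n) ℂ k) :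
    cubesCombination a k g = ∑ j, (g j).1 * linearForm (a j) ^ 3 := by
  simp [cubesCombination, LinearMap.sum_apply]

theorem finrank_ker_cubesCombination {r n : ℕ} (a : Fin r → Fin n → ℂ) (k : ℕ) :
    Module.finrank ℂ (LinearMap.ker (cubesCombination a k)) =
      Module.finrank ℂ (syzygies a k) := by
  let ι : (Fin r → homogeneousSubmodule (Fin n) ℂ k) →ₗ[ℂ] (Fin r → MvPolynomial (Fin n) ℂ) :=
    LinearMap.pi fun j => Submodule.subtype _ ∘ₗ LinearMap.proj j
  have hι : Function.Injective ι := fun f g h => funext fun j => Subtype.ext (congrFun h j)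
  have : syzygies a k = (LinearMap.ker (cubesCombination a k)).map ι := by
    ext g
    rw [Submodule.mem_map]
    constructor
    · intro hg
      refine ⟨fun j => ⟨g j, hg.1 j⟩, ?_, rfl⟩
      rw [LinearMap.mem_ker, cubesCombination_apply]
      exact hg.2
    · rintro ⟨g, hg, rfl⟩
      rw [LinearMap.mem_ker, cubesCombination_apply] at hg
      exact ⟨fun j => (g j).2, hg⟩
  rw [this]
  exact (Submodule.equivMapOfInjective ι hι _).finrank_eq

theorem range_cubesCombination {r n : ℕ} (a : Fin r → Fin n → ℂ) (k : ℕ) :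
    LinearMap.range (cubesCombination a k) =
      homogeneousSubmodule (Fin n) ℂ (k + 3) ⊓ (cubesIdeal a).restrictScalars ℂ := by
  have h3 : ∀ j, (linearForm (a j) ^ 3).IsHomogeneous 3 := fun j =>
    (linearForm_isHomogeneous (a j)).pow 3
  ext f
  constructor
  · rintro ⟨g, rfl⟩
    rw [cubesCombination_apply]
    exact ⟨Submodule.sum_mem _ fun j _ => (g j).2.mul (h3 j), Ideal.sum_mem _ fun j _ =>
      Ideal.mul_mem_left _ _ (Ideal.subset_span ⟨j, rfl⟩)⟩
  · rintro ⟨hf, hfI⟩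
    obtain ⟨g, hg⟩ := Ideal.mem_span_range_iff_exists_fun.1 hfI
    refine ⟨fun j => ⟨homogeneousComponent k (g j), homogeneousComponent_isHomogeneous _ _⟩, ?_⟩
    rw [cubesCombination_apply]
    exact IsHomogeneous.eq_sum_homogeneousComponent_mul hf h3 hg

/-- Rank count along the exact sequence from syzygies of degree `k` through `S_k^r` and `S_{k+3}` to
`A_{k+3}`, written without subtraction. -/
theorem finrank_gradedPiece {r n : ℕ} (a : Fin r → Fin n → ℂ) (k : ℕ) :
    Module.finrank ℂ (gradedPiece (cubesIdeal a) (k + 3)) + r * (n + k - 1).choose k =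
      (n + (k + 3) - 1).choose (k + 3) + Module.finrank ℂ (syzygies a k) := by
  have h1 := LinearMap.finrank_range_add_finrank_ker (cubesCombination a k)
  rw [finrank_ker_cubesCombination, range_cubesCombination, Module.finrank_pi_fintype,
    Finset.sum_const, Finset.card_univ, Fintype.card_fin, finrank_homogeneousSubmodule,
    smul_eq_mul] at h1
  let q : homogeneousSubmodule (Fin n) ℂ (k + 3) →ₗ[ℂ] MvPolynomial (Fin n) ℂ ⧸ cubesIdeal a :=
    (Ideal.Quotient.mkₐ ℂ (cubesIdeal a)).toLinearMap ∘ₗ (homogeneousSubmodule (Fin n) ℂ (k +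
        3)).subtype
  have h2 := LinearMap.finrank_range_add_finrank_ker q
  have hr : LinearMap.range q = gradedPiece (cubesIdeal a) (k + 3) := by
    rw [LinearMap.range_comp, Submodule.range_subtype]
    rfl
  have hk : (LinearMap.ker q).map (homogeneousSubmodule (Fin n) ℂ (k + 3)).subtype =
      homogeneousSubmodule (Fin n) ℂ (k + 3) ⊓ (cubesIdeal a).restrictScalars ℂ := by
    ext f
    simp only [Submodule.mem_map, LinearMap.mem_ker, Submodule.mem_inf]
    constructor
    · rintro ⟨f, hf, rfl⟩
      exact ⟨f.2, Ideal.Quotient.eq_zero_iff_mem.1 hf⟩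
    · rintro ⟨hf, hfI⟩
      exact ⟨⟨f, hf⟩, Ideal.Quotient.eq_zero_iff_mem.2 hfI, rfl⟩
  rw [hr, ← Submodule.finrank_map_subtype_eq (homogeneousSubmodule (Fin n) ℂ (k +
      3)) (LinearMap.ker q), hk,
    finrank_homogeneousSubmodule] at h2
  omega

theorem finrank_syzygies_two {a : Fin 8 → Fin 7 → ℂ} (ha : InGeneralPosition a) :
    Module.finrank ℂ (syzygies a 2) = 0 := by
  have : syzygies a 2 = ⊥ := by
    rw [Submodule.eq_bot_iff]
    exact fun g hg => eq_zero_of_sum_mul_linearForm ha hg.1 hg.2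
  rw [this, finrank_bot]

/-- The Koszul syzygies. -/
noncomputable def koszulSyzygy {r n : ℕ} (a : Fin r → Fin n → ℂ) :
    ({x : Fin r × Fin r // x.1 < x.2} → ℂ) →ₗ[ℂ] (Fin r → MvPolynomial (Fin n) ℂ) where
  -- `c` is the upper triangle of a skew-symmetric matrix, here applied to the vector of cubes.
  toFun c j := ∑ i, C ((if h : i < j then c ⟨(i, j), h⟩ else 0) -
    if h : j < i then c ⟨(j, i), h⟩ else 0) * linearForm (a i) ^ 3
  map_add' c c' := by
    ext1 j
    rw [Pi.add_apply, ← Finset.sum_add_distrib]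
    refine Finset.sum_congr rfl fun i _ => ?_
    rw [← add_mul, ← C_add]
    congr 2
    split_ifs <;> first | (simp only [Pi.add_apply]; ring) | simp
  map_smul' t c := by
    ext1 j
    rw [Pi.smul_apply, Finset.smul_sum]
    refine Finset.sum_congr rfl fun i _ => ?_
    rw [RingHom.id_apply, smul_eq_C_mul, ← mul_assoc, ← C_mul]
    congr 2
    split_ifs <;> first | (simp only [Pi.smul_apply, smul_eq_mul]; ring) | simp

theorem koszulSyzygy_apply {r n : ℕ} (a : Fin r → Fin n → ℂ)
    (c : {x : Fin r × Fin r // x.1 < x.2} → ℂ) (j : Fin r) :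
    koszulSyzygy a c j = ∑ i, C ((if h : i < j then c ⟨(i, j), h⟩ else 0) -
      if h : j < i then c ⟨(j, i), h⟩ else 0) * linearForm (a i) ^ 3 := rfl

theorem koszulSyzygy_mem {r n : ℕ} (a : Fin r → Fin n → ℂ)
    (c : {x : Fin r × Fin r // x.1 < x.2} → ℂ) : koszulSyzygy a c ∈ syzygies a 3 := by
  refine ⟨fun j => ?_, ?_⟩
  · rw [koszulSyzygy_apply]
    exact Submodule.sum_mem _ fun i _ => ((linearForm_isHomogeneous (a i)).pow 3).C_mul _
  have hanti : ∑ j, koszulSyzygy a c j * linearForm (a j) ^ 3 =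
      -∑ j, koszulSyzygy a c j * linearForm (a j) ^ 3 := by
    simp only [koszulSyzygy_apply, Finset.sum_mul]
    conv_lhs => rw [Finset.sum_comm]
    rw [← Finset.sum_neg_distrib]
    refine Finset.sum_congr rfl fun j _ => ?_
    rw [← Finset.sum_neg_distrib]
    refine Finset.sum_congr rfl fun i _ => ?_
    rw [C_sub, C_sub]
    ring
  exact self_eq_neg.1 hanti

/-- The `28 = C(8, 2)` Koszul syzygies are independent: a vanishing combination gives
constant-coefficient relations between the cubes, and multiplying these by `x₀²` gives syzygies of
degree 2, which are zero. -/
theorem le_finrank_syzygies_three {a : Fin 8 → Fin 7 → ℂ} (ha : InGeneralPosition a) :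
    28 ≤ Module.finrank ℂ (syzygies a 3) := by
  have : FiniteDimensional ℂ (syzygies a 3) := by
    let ι : (Fin 8 → homogeneousSubmodule (Fin 7) ℂ 3) →ₗ[ℂ] (Fin 8 → MvPolynomial (Fin 7) ℂ) :=
      LinearMap.pi fun j => Submodule.subtype _ ∘ₗ LinearMap.proj j
    exact Submodule.finiteDimensional_of_le (S₂ := LinearMap.range ι)
      fun g hg => ⟨fun j => ⟨g j, hg.1 j⟩, rfl⟩
  have hinj : Function.Injective (koszulSyzygy a) := by
    rw [injective_iff_map_eq_zero]
    intro c hc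
    ext ⟨⟨i, j⟩, hij⟩
    have hq := eq_zero_of_sum_mul_linearForm ha (q := fun i =>
      C ((if h : i < j then c ⟨(i, j), h⟩ else 0) - if h : j < i then c ⟨(j, i), h⟩ else 0) *
        X 0 ^ 2) (fun i => (isHomogeneous_X_pow 0 2).C_mul _) (by
      have := congrFun hc j
      rw [Pi.zero_apply] at this
      calc _ = koszulSyzygy a c j * X 0 ^ 2 := by
            simp only [koszulSyzygy_apply, Finset.sum_mul]
            exact Finset.sum_congr rfl fun i _ => by ring
        _ = 0 := by rw [this, zero_mul])
    have h1 := (mul_eq_zero.1 (congrFun hq i)).resolve_right (pow_ne_zero 2 (X_ne_zero 0))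
    have hij' : i < j := hij
    rw [dif_pos hij', dif_neg (not_lt.2 hij'.le), sub_zero] at h1
    exact C_injective _ _ (h1.trans C_0.symm)
  have hcard : Fintype.card {x : Fin 8 × Fin 8 // x.1 < x.2} = 28 := by decide
  rw [← hcard, ← Module.finrank_fintype_fun_eq_card ℂ]
  exact LinearMap.finrank_le_finrank_of_injective
    (f := (koszulSyzygy a).codRestrict (syzygies a 3) (koszulSyzygy_mem a))
    ((LinearMap.injective_codRestrict_iff _).2 hinj)

theorem InGeneralPosition.castSucc {r n : ℕ} {p : Fin (r + 1) → Fin n → ℂ}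
    (h : InGeneralPosition p) : InGeneralPosition fun j : Fin r => p j.castSucc :=
  fun e => h (e.trans Fin.castSuccEmb)

theorem mainTheorem2 :
    -- `v 0, …, v 7` are the coefficient vectors of `L₁, …, L₈`, and `v 8` is that of `L`
    ForGeneral (fun v : Fin 9 → Fin 7 → ℂ =>
      let a : Fin 8 → Fin 7 → ℂ := fun j => v j.castSucc
      let I := cubesIdeal a
      let s := Module.finrank ℂ (syzygies a 3)
      Module.finrank ℂ (gradedPiece I 5) = 238 ∧
      28 ≤ s ∧
      Module.finrank ℂ (gradedPiece I 6) = 280 + (s - 28) ∧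
      s + 15 ≤ Module.finrank ℂ (gradedPiece I 6 ⧸ LinearMap.range (mulMap I 5 (v (Fin.last 8)))) ∧
      ¬ Function.Injective (mulMap I 5 (v (Fin.last 8))) ∧
      ¬ HasWLPInDegree I 5) ∧
    -- `p 0, …, p 8` are nine points of `ℙ⁵`
    ForGeneral (fun p : Fin 9 → Fin 6 → ℂ =>
      let q : Fin 8 → Fin 6 → ℂ := fun j => p j.castSucc
      Module.finrank ℂ (formsWithMultiplicity 3 2 p) = 2 ∧
      Module.finrank ℂ (formsWithMultiplicity 3 2 q) = 8 ∧
      -- the span of all products of a cubic of the first space and one of the second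
      Module.finrank ℂ ↥(formsWithMultiplicity 3 2 p * formsWithMultiplicity 3 2 q) = 15 ∧
      formsWithMultiplicity 3 2 p * formsWithMultiplicity 3 2 q ≤ formsWithMultiplicity 6 4 q) := by

  refine ⟨(forGeneral_inGeneralPosition 9 7).mono fun v hv => ?_, forGeneral_singular_cubics⟩
  intro a I s
  have ha : InGeneralPosition a := hv.castSucc
  have h5 : Module.finrank ℂ (gradedPiece I 5) + 8 * 28 = 462 := by
    have : Module.finrank ℂ (gradedPiece I 5) + 8 * 28 =
      462 + Module.finrank ℂ (syzygies a 2) := finrank_gradedPiece a 2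
    rwa [finrank_syzygies_two ha] at this
  have h6 : Module.finrank ℂ (gradedPiece I 6) + 8 * 84 = 924 + s := finrank_gradedPiece a 3
  have hs : 28 ≤ s := le_finrank_syzygies_three ha
  have hinj : ∀ b, ¬ Function.Injective (mulMap I 5 b) := not_injective_mulMap ha
  have h5' : Module.finrank ℂ (gradedPiece I 5) = 238 := by omega
  refine ⟨h5', hs, by omega, ?_, hinj _, ?_⟩
  · have hr := LinearMap.finrank_range_add_finrank_ker (mulMap I 5 (v (Fin.last 8)))
    have hk : 0 < Module.finrank ℂ (LinearMap.ker (mulMap I 5 (v (Fin.last 8)))) :=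
      Nat.pos_of_ne_zero fun h => hinj _ (LinearMap.ker_eq_bot.1 (Submodule.finrank_eq_zero.1 h))
    have hq : Module.finrank ℂ (gradedPiece I 6 ⧸ LinearMap.range (mulMap I 5 (v (Fin.last 8)))) +
        Module.finrank ℂ (LinearMap.range (mulMap I 5 (v (Fin.last 8)))) =
        Module.finrank ℂ (gradedPiece I 6) := Submodule.finrank_quotient_add_finrank _
    omega
  · rintro ⟨b, hb | hb⟩
    · exact hinj b hb
    -- Surjectivity is impossible by dimension: `dim A₆ ≥ 280 > 238`.
    · have : Module.finrank ℂ (gradedPiece I 6) ≤ Module.finrank ℂ (gradedPiece I 5) :=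
        LinearMap.finrank_le_finrank_of_surjective hb
      omega
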